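/- Let $\mathbb{C}H^n=G/K$ be the complex hyperbolic space of constant holomorphic sectional curvature $-1$, with $G=SU(1,n)$ and $K=S(U(1)U(n))$ the isotropy group at $o\in\mathbb{C}H^n$, and let $\mathfrak g=\mathfrak{su}(1,n)=\mathfrak k\oplus\mathfrak p$ be the Cartan decomposition at $o$. Let $\mathfrak a\subset\mathfrak p$ be a maximal abelian (hence one-dimensional) subspace, spanned by a unit vector $B$ for the metric on $T_o\mathbb{C}H^n\cong\mathfrak p$, and let $\alpha$ be the restricted root with $\alpha(B)=\tfrac12$, so that $\mathfrak g_\alpha=\{Y\in\mathfrak g:[B,Y]=\tfrac12Y\}$ and $\mathfrak g_{2\alpha}=\{Y\in\mathfrak g:[B,Y]=Y\}$. Put $\mathfrak n=\mathfrak g_\alpha\oplus\mathfrak g_{2\alpha}$ and let $AN$ be the connected subgroup of $G$ with Lie algebra $\mathfrak a\oplus\mathfrak n$. It acts simply transitively on $\mathbb{C}H^n$; endow it with the left-invariant metric that makes $AN\to\mathbb{C}H^n$, $g\mapsto g\cdot o$, an isometry, and let $\langle\cdot,\cdot\rangle$ and $\lVert\cdot\rVert$ be the resulting inner product and norm on $\mathfrak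 a\oplus\mathfrak n$. Elements of $\mathfrak a\oplus\mathfrak n$ are regarded as left-invariant vector fields on $AN\cong\mathbb{C}H^n$. The mean curvature vector $\mathcal H$ of a submanifold is the trace of its second fundamental form (not divided by the dimension). Let $\mathfrak w$ be a real linear subspace of $\mathfrak g_\alpha$. (1) Let $a\in\mathbb R$, $a\neq0$, and let $X\in\mathfrak g_\alpha$, $X\neq0$, be orthogonal to $\mathfrak w$. Then $\mathfrak h=\mathbb R(aB+X)\oplus\mathfrak w\oplus\mathfrak g_{2\alpha}$ is a Lie subalgebra of $\mathfrak g$, and if $H$ is the connected Lie subgroup of $SU(1,n)$ with Lie algebra $\mathfrak h$, the mean curvature vector of the orbit $H\cdot o$ is \[ \mathcal H=\frac{3+\dim\mathfrak w}{2(a^2+\lVert X\rVert^2)}\bigl(\lVert X\rVert^2B-aX\bigr). \] (2) Let $\mathfrak b\in\{0,\mathfrak a\}$. Then $\mathfrak h=\mathfrak b\oplus\mathfrak w\oplus\mathfrak g_{2\alpha}$ is a Lie subalgebra of $\mathfrak g$, and if $H$ is the connected Lie subgroup of $SU(1,n)$ with Lie algebra $\mathfrak h$, the mean curvature vector of the orbit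 $H\cdot o$ is \[ \mathcal H=\begin{cases}0,&\text{if }\mathfrak b=\mathfrak a,\\ \tfrac12(2+\dim\mathfrak w)\,B,&\text{if }\mathfrak b=0.\end{cases} \] -/

import Mathlib

open scoped ContDiff Matrix

attribute [local instance 100] LieRing.ofAssociativeRing

noncomputable section

namespace ComplexHyperbolic

section Riemannian

/-! Submanifold geometry in an open subset of a real normed space `E` carrying a Riemannian
metric `g`, where `g p u v` is the inner product at `p` of the tangent vectors `u` and `v`. -/

variable {E : Type*} [NormedAddCommGroup E] [NormedSpace ℝ E]

/-- The Christoffel symbols of the first kind of the Levi-Civita connection of `g`: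
`g (∇_u v, w)` at `p` for the constant vector fields `u`, `v`, `w`. -/
def christoffel (g : E → E → E → ℝ) (p u v w : E) : ℝ :=
  (fderiv ℝ (fun z => g z v w) p u + fderiv ℝ (fun z => g z u w) p v
    - fderiv ℝ (fun z => g z u v) p w) / 2

/-- For a map `f` into `E`, the number `g (∇_u (df v), ν)` at `t`. If `ν` is normal to `f` at `t`
this is the second fundamental form of `f` in the direction `ν`, that is, the inner product of
`S_ν u` and `v` with `S_ν` the shape operator. -/
def secondFundamentalForm (g : E → E → E → ℝ) {k : ℕ} (f : (Fin k → ℝ) → E) (t : Fin k → ℝ)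
    (ν : E) (u v : Fin k → ℝ) : ℝ :=
  g (f t) (fderiv ℝ (fun s => fderiv ℝ f s) t u v) ν
    + christoffel g (f t) (fderiv ℝ f t u) (fderiv ℝ f t v) ν

/-- `η` is the mean curvature vector at `t` of the immersion `f`: it is normal to `f`, and its
inner product with any normal vector `ν` is the trace of the shape operator `S_ν`, computed in a
basis `e` that is orthonormal for the induced metric. -/
structure HasMeanCurvatureVector (g : E → E → E → ℝ) {k : ℕ} (f : (Fin k → ℝ) → E)
    (t : Fin k → ℝ) (η : E) : Prop where
  smooth : ContDiffAt ℝ ∞ f t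
  immersion : Function.Injective (fderiv ℝ f t)
  normal : ∀ u, g (f t) η (fderiv ℝ f t u) = 0
  trace : ∃ e : Fin k → (Fin k → ℝ),
    (∀ i j, g (f t) (fderiv ℝ f t (e i)) (fderiv ℝ f t (e j)) = if i = j then 1 else 0) ∧
    ∀ ν, (∀ u, g (f t) ν (fderiv ℝ f t u) = 0) →
      g (f t) η ν = ∑ i, secondFundamentalForm g f t ν (e i) (e i)

end Riemannian

/-- The metric of constant holomorphic sectional curvature `-1` on the unit ball of `ℂⁿ`, which is
the ball model of `ℂHⁿ`. -/
def metric {n : ℕ} (z u v : EuclideanSpace ℂ (Fin n)) : ℝ :=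
  4 * (inner ℂ u v / (1 - (‖z‖ : ℂ) ^ 2)
    + inner ℂ u z * inner ℂ z v / (1 - (‖z‖ : ℂ) ^ 2) ^ 2).re

/-- The matrix of the Hermitian form of signature `(1, n)`. -/
def form (n : ℕ) : Matrix (Fin (n + 1)) (Fin (n + 1)) ℂ :=
  Matrix.diagonal (Fin.cons (-1) fun _ => 1)

/-- The group `SU(1,n)`. -/
def SU (n : ℕ) : Subgroup (Matrix.SpecialLinearGroup (Fin (n + 1)) ℂ) where
  carrier := {g | (g : Matrix (Fin (n + 1)) (Fin (n + 1)) ℂ)ᴴ * form n * g.1 = form n}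
  one_mem' := by simp
  mul_mem' := by
    intro a b ha hb
    simp only [Set.mem_ofPred_eq, Matrix.SpecialLinearGroup.coe_mul,
      Matrix.conjTranspose_mul] at *
    calc b.1ᴴ * a.1ᴴ * form n * (a.1 * b.1)
        = b.1ᴴ * (a.1ᴴ * form n * a.1) * b.1 := by simp only [Matrix.mul_assoc]
      _ = form n := by rw [ha, hb]
  inv_mem' := by
    intro a ha
    simp only [Set.mem_ofPred_eq] at *
    have h : a.1 * (a⁻¹).1 = 1 := by
      rw [← Matrix.SpecialLinearGroup.coe_mul, mul_inv_cancel, Matrix.SpecialLinearGroup.coe_one]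
    have h' : (a⁻¹).1ᴴ * a.1ᴴ = 1 := by
      rw [← Matrix.conjTranspose_mul, h, Matrix.conjTranspose_one]
    calc (a⁻¹).1ᴴ * form n * (a⁻¹).1
        = (a⁻¹).1ᴴ * (a.1ᴴ * form n * a.1) * (a⁻¹).1 := by rw [ha]
      _ = ((a⁻¹).1ᴴ * a.1ᴴ) * form n * (a.1 * (a⁻¹).1) := by simp only [Matrix.mul_assoc]
      _ = form n := by rw [h, h', Matrix.one_mul, Matrix.mul_one]

/-- The real Lie algebra `su(1,n)`. -/
def su (n : ℕ) : LieSubalgebra ℝ (Matrix (Fin (n + 1)) (Fin (n + 1)) ℂ) where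
  carrier := {A | Aᴴ * form n + form n * A = 0 ∧ A.trace = 0}
  zero_mem' := by simp
  add_mem' := by
    rintro A C ⟨hA, hA'⟩ ⟨hC, hC'⟩
    refine ⟨?_, by simp [hA', hC']⟩
    calc (A + C)ᴴ * form n + form n * (A + C)
        = (Aᴴ * form n + form n * A) + (Cᴴ * form n + form n * C) := by
          rw [Matrix.conjTranspose_add]; noncomm_ring
      _ = 0 := by rw [hA, hC, add_zero]
  smul_mem' := by
    rintro c A ⟨hA, hA'⟩
    refine ⟨?_, by simp [hA']⟩
    rw [Matrix.conjTranspose_smul, star_trivial, Matrix.smul_mul, Matrix.mul_smul, ← smul_add,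
      hA, smul_zero]
  lie_mem' := by
    rintro A C ⟨hA, -⟩ ⟨hC, -⟩
    have hA1 : Aᴴ * form n = -(form n * A) := eq_neg_of_add_eq_zero_left hA
    have hC1 : Cᴴ * form n = -(form n * C) := eq_neg_of_add_eq_zero_left hC
    refine ⟨?_, by rw [Ring.lie_def, Matrix.trace_sub, Matrix.trace_mul_comm, sub_self]⟩
    rw [Ring.lie_def, Matrix.conjTranspose_sub, Matrix.conjTranspose_mul,
      Matrix.conjTranspose_mul, sub_mul, Matrix.mul_assoc, Matrix.mul_assoc, hA1, hC1,
      Matrix.mul_neg, Matrix.mul_neg, ← Matrix.mul_assoc, ← Matrix.mul_assoc, hA1, hC1]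
    noncomm_ring

/-- The action on the ball by fractional linear maps: `z` is the negative line spanned by
`(1, z)`. -/
def act {n : ℕ} (A : Matrix (Fin (n + 1)) (Fin (n + 1)) ℂ) (z : EuclideanSpace ℂ (Fin n)) :
    EuclideanSpace ℂ (Fin n) :=
  WithLp.toLp 2 fun i =>
    (A *ᵥ Fin.cons 1 fun j => z j) i.succ / (A *ᵥ Fin.cons 1 fun j => z j) 0

/-- The base point `o`, whose isotropy group is `S(U(1)U(n))`. -/
def basePoint (n : ℕ) : EuclideanSpace ℂ (Fin n) := 0

/-- The tangent vector at `g · o` that is the image under the differential of `g` of the tangent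
vector of `s ↦ exp(sY) · o` at `s = 0`. If `g` and `Y` belong to `AN` and its Lie algebra, this is
the value at `g · o` of the left-invariant vector field `Y`, for `AN` identified with `ℂHⁿ` through
`g ↦ g · o`. -/
def leftInvariantVector {n : ℕ} (g : SU n) (Y : su n) : EuclideanSpace ℂ (Fin n) :=
  deriv (fun s : ℝ => act (g.1.1 * NormedSpace.exp (s • Y.1)) (basePoint n)) 0

/-- On the Lie algebra of `AN`, the inner product that makes `g ↦ g · o` an isometry. -/
def innerAN {n : ℕ} (Y Y' : su n) : ℝ :=
  metric (basePoint n) (leftInvariantVector 1 Y) (leftInvariantVector 1 Y')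

/-- The `(-1)`-eigenspace `𝔭` of the Cartan involution `θ A = -Aᴴ` at `o`. -/
def cartanP (n : ℕ) : Submodule ℝ (su n) where
  carrier := {A | A.1ᴴ = A.1}
  zero_mem' := by simp
  add_mem' := by
    intro A C hA hC
    simp only [Set.mem_ofPred_eq] at *
    simp [hA, hC]
  smul_mem' := by
    intro c A hA
    simp only [Set.mem_ofPred_eq] at *
    simp [hA]

/-- The restricted root space `{A : [B, A] = c A}` of `𝔞 = ℝB`, for the functional on `𝔞` with
value `c` at `B`. -/
def rootSpace {n : ℕ} (B : su n) (c : ℝ) : Submodule ℝ (su n) :=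
  (LieAlgebra.ad ℝ (su n) B).eigenspace c

/-- The connected Lie subgroup of `SU(1,n)` with Lie algebra `𝔥`: the subgroup generated by the
exponentials of the elements of `𝔥`. -/
def connectedSubgroup {n : ℕ} (𝔥 : LieSubalgebra ℝ (su n)) : Subgroup (SU n) :=
  Subgroup.closure {g | ∃ A ∈ 𝔥, g.1.1 = NormedSpace.exp (A : su n).1}

/-- The orbit map `H → ℂHⁿ`, `h ↦ h · o`, in the exponential chart of the Lie group `H` at `g`
that is given by the basis `v` of its Lie algebra. -/
def orbitMap {n k : ℕ} {𝔥 : LieSubalgebra ℝ (su n)} (v : Module.Basis (Fin k) ℝ 𝔥) (g : SU n)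
    (t : Fin k → ℝ) : EuclideanSpace ℂ (Fin n) :=
  act (g.1.1 * NormedSpace.exp (∑ i, t i • (v i).1.1)) (basePoint n)

/-- The mean curvature vector field of the orbit through `o` of the connected Lie subgroup `H` with
Lie algebra `𝔥` is given by the left-invariant vector field `Y`. The orbit is the immersed
submanifold parametrized by the orbit map of the Lie group `H`. -/
def OrbitHasMeanCurvature {n : ℕ} (𝔥 : LieSubalgebra ℝ (su n)) (Y : su n) : Prop :=
  ∀ g ∈ connectedSubgroup 𝔥, ∀ (k : ℕ) (v : Module.Basis (Fin k) ℝ 𝔥),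
    HasMeanCurvatureVector metric (orbitMap v g) 0 (leftInvariantVector g Y)

end ComplexHyperbolic

end

/-! Since `SU(1,n)` acts by isometries, it suffices to compute at `o`, where the Christoffel symbols
of the ball model vanish, so that the second fundamental form of the orbit on `A ∈ 𝔥` is the normal
part of the acceleration of the curve `s ↦ exp(sA) · o`. Let `v` be the initial velocity of this
curve. The eigenvalue equation `[B, A] = cA` determines `A` from `v`, and yields the acceleration
`½‖X‖²B` for `X ∈ 𝔤_α` and `‖Z‖²B` for `Z ∈ 𝔤_{2α}`, as well as `½(‖X‖²B - aX)` for `aB + X`. The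
root space `𝔤_{2α}` is spanned by the rank one operator attached to an isotropic eigenvector of
`B`. Hence each unit vector of `𝔴` contributes `½⟨B, ν⟩` to the trace of the shape operator in the
normal direction `ν`, the unit vector of `𝔤_{2α}` contributes `⟨B, ν⟩`, and the unit vector along
`aB + X` contributes `½⟨B, ν⟩`, because `⟨‖X‖²B - aX, ν⟩ = (a² + ‖X‖²)⟨B, ν⟩` for `ν` orthogonal to
`aB + X`. -/

noncomputable section

open Filter Topology

namespace ComplexHyperbolic

section LocalIsometry

variable {E F : Type*} [NormedAddCommGroup E] [NormedSpace ℝ E]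
  [NormedAddCommGroup F] [NormedSpace ℝ F]

/-- `φ` is, near `p`, a local isometry from the metric `G` to the metric `G'`. In contrast to
`christoffel`, metrics are families of continuous bilinear forms here, so that the derivative of
`z ↦ G' (φ z)` makes sense. -/
structure IsLocalIsometryAt (G : E → E →L[ℝ] E →L[ℝ] ℝ) (G' : F → F →L[ℝ] F →L[ℝ] ℝ) (φ : E → F)
    (p : E) : Prop where
  contDiffAt : ContDiffAt ℝ ∞ φ p
  bijective : Function.Bijective (fderiv ℝ φ p)
  pullback : ∀ᶠ z in 𝓝 p, ∀ u v, G' (φ z) (fderiv ℝ φ z u) (fderiv ℝ φ z v) = G z u v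

theorem differentiableAt_fderiv {φ : E → F} {p : E} (hφ : ContDiffAt ℝ 2 φ p) :
    DifferentiableAt ℝ (fderiv ℝ φ) p :=
  (hφ.fderiv_right (m := 1) (by norm_cast)).differentiableAt one_ne_zero

theorem fderiv_fderiv_comp_apply {D : Type*} [NormedAddCommGroup D] [NormedSpace ℝ D] {φ : E → F}
    {f : D → E} {t : D} (hφ : ContDiffAt ℝ 2 φ (f t)) (hf : ContDiffAt ℝ 2 f t) (u v : D) :
    fderiv ℝ (fderiv ℝ (φ ∘ f)) t u v =
      fderiv ℝ (fderiv ℝ φ) (f t) (fderiv ℝ f t u) (fderiv ℝ f t v)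
        + fderiv ℝ φ (f t) (fderiv ℝ (fderiv ℝ f) t u v) := by
  have fderiv_comp_eventually :
      fderiv ℝ (φ ∘ f) =ᶠ[𝓝 t] fun s => (fderiv ℝ φ (f s)).comp (fderiv ℝ f s) := by
    filter_upwards [hf.continuousAt.eventually (hφ.eventually (by simp)), hf.eventually (by simp)]
      with s hφs hfs
    exact fderiv_comp s (hφs.differentiableAt two_ne_zero) (hfs.differentiableAt two_ne_zero)
  have hasFDerivAt_outer : HasFDerivAt (fun s => fderiv ℝ φ (f s))
      ((fderiv ℝ (fderiv ℝ φ) (f t)).comp (fderiv ℝ f t)) t :=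
    (differentiableAt_fderiv hφ).hasFDerivAt.comp t (hf.differentiableAt two_ne_zero).hasFDerivAt
  rw [fderiv_comp_eventually.fderiv_eq,
    (hasFDerivAt_outer.clm_comp (differentiableAt_fderiv hf).hasFDerivAt).fderiv]
  simp [add_comm]

namespace IsLocalIsometryAt

variable {G : E → E →L[ℝ] E →L[ℝ] ℝ} {G' : F → F →L[ℝ] F →L[ℝ] ℝ} {φ : E → F} {p : E}

theorem fderiv_metric (hφ : IsLocalIsometryAt G G' φ p) (hG' : DifferentiableAt ℝ G' (φ p))
    (u v w : E) :
    fderiv ℝ (fun z => G z u v) p w =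
      fderiv ℝ (fun z => G' z (fderiv ℝ φ p u) (fderiv ℝ φ p v)) (φ p) (fderiv ℝ φ p w)
        + G' (φ p) (fderiv ℝ (fderiv ℝ φ) p w u) (fderiv ℝ φ p v)
        + G' (φ p) (fderiv ℝ φ p u) (fderiv ℝ (fderiv ℝ φ) p w v) := by
  have pullback_eventually :
      (fun z => G z u v) =ᶠ[𝓝 p] fun z => G' (φ z) (fderiv ℝ φ z u) (fderiv ℝ φ z v) :=
    hφ.pullback.mono fun z hz => (hz u v).symm
  have hφ₁ : HasFDerivAt φ (fderiv ℝ φ p) p :=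
    (hφ.contDiffAt.differentiableAt (by simp)).hasFDerivAt
  have hφ₂ : HasFDerivAt (fderiv ℝ φ) (fderiv ℝ (fderiv ℝ φ) p) p :=
    (differentiableAt_fderiv (hφ.contDiffAt.of_le (by norm_cast))).hasFDerivAt
  have hasFDerivAt_comp : HasFDerivAt (fun z => G' (φ z))
      ((fderiv ℝ G' (φ p)).comp (fderiv ℝ φ p)) p :=
    HasFDerivAt.comp (g := G') p hG'.hasFDerivAt hφ₁
  have hasFDerivAt_pullback :=
    (hasFDerivAt_comp.clm_apply (hφ₂.clm_apply (hasFDerivAt_const u p))).clm_apply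
      (hφ₂.clm_apply (hasFDerivAt_const v p))
  have hasFDerivAt_const_args :=
    (hG'.hasFDerivAt.clm_apply (hasFDerivAt_const (fderiv ℝ φ p u) (φ p))).clm_apply
      (hasFDerivAt_const (fderiv ℝ φ p v) (φ p))
  rw [pullback_eventually.fderiv_eq, hasFDerivAt_pullback.fderiv, hasFDerivAt_const_args.fderiv]
  simp
  ring

theorem christoffel_eq (hφ : IsLocalIsometryAt G G' φ p) (hG' : DifferentiableAt ℝ G' (φ p))
    (hsymm : ∀ u v, G' (φ p) u v = G' (φ p) v u) (u v w : E) :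
    christoffel (fun z u v => G z u v) p u v w =
      christoffel (fun z u v => G' z u v) (φ p) (fderiv ℝ φ p u) (fderiv ℝ φ p v) (fderiv ℝ φ p w)
        + G' (φ p) (fderiv ℝ (fderiv ℝ φ) p u v) (fderiv ℝ φ p w) := by
  have hess_symm : IsSymmSndFDerivAt ℝ φ p :=
    hφ.contDiffAt.isSymmSndFDerivAt (by simpa using by norm_cast)
  simp only [christoffel, hφ.fderiv_metric hG']
  rw [hess_symm.eq w u, hess_symm.eq w v, hess_symm.eq v u,
    hsymm (fderiv ℝ φ p v) (fderiv ℝ (fderiv ℝ φ) p u w)]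
  ring

variable {k : ℕ} {f : (Fin k → ℝ) → E} {t : Fin k → ℝ}

theorem secondFundamentalForm_comp (hφ : IsLocalIsometryAt G G' φ (f t))
    (hG' : DifferentiableAt ℝ G' (φ (f t)))
    (hsymm : ∀ u v, G' (φ (f t)) u v = G' (φ (f t)) v u) (hf : ContDiffAt ℝ 2 f t) (ν : E)
    (u v : Fin k → ℝ) :
    secondFundamentalForm (fun z u v => G' z u v) (φ ∘ f) t (fderiv ℝ φ (f t) ν) u v =
      secondFundamentalForm (fun z u v => G z u v) f t ν u v := by
  have hφ₂ : ContDiffAt ℝ 2 φ (f t) := hφ.contDiffAt.of_le (by norm_cast)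
  simp only [secondFundamentalForm]
  rw [fderiv_fderiv_comp_apply hφ₂ hf, hφ.christoffel_eq hG' hsymm, Function.comp_apply,
    fderiv_comp t (hφ₂.differentiableAt two_ne_zero) (hf.differentiableAt two_ne_zero),
    ContinuousLinearMap.comp_apply, ContinuousLinearMap.comp_apply, map_add, add_apply,
    hφ.pullback.self_of_nhds]
  ring

theorem hasMeanCurvatureVector_comp (hφ : IsLocalIsometryAt G G' φ (f t))
    (hG' : DifferentiableAt ℝ G' (φ (f t)))
    (hsymm : ∀ u v, G' (φ (f t)) u v = G' (φ (f t)) v u) {η : E}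
    (hf : HasMeanCurvatureVector (fun z u v => G z u v) f t η) :
    HasMeanCurvatureVector (fun z u v => G' z u v) (φ ∘ f) t (fderiv ℝ φ (f t) η) := by
  have fderiv_comp_apply (u : Fin k → ℝ) :
      fderiv ℝ (φ ∘ f) t u = fderiv ℝ φ (f t) (fderiv ℝ f t u) := by
    rw [fderiv_comp t (hφ.contDiffAt.differentiableAt (by simp))
      (hf.smooth.differentiableAt (by simp)), ContinuousLinearMap.comp_apply]
  have pullback_apply := hφ.pullback.self_of_nhds
  obtain ⟨e, orthonormal_e, trace_e⟩ := hf.trace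
  refine ⟨hφ.contDiffAt.comp t hf.smooth, fun u v huv => hf.immersion (hφ.bijective.1 ?_),
    fun u => ?_, e, fun i j => ?_, fun ν hν => ?_⟩
  · simpa only [fderiv_comp_apply] using huv
  · rw [fderiv_comp_apply, Function.comp_apply, pullback_apply, hf.normal]
  · rw [fderiv_comp_apply, fderiv_comp_apply, Function.comp_apply, pullback_apply, orthonormal_e]
  · obtain ⟨ν, rfl⟩ := hφ.bijective.2 ν
    rw [Function.comp_apply, pullback_apply, trace_e ν fun u => ?_]
    · exact Finset.sum_congr rfl fun i _ => (hφ.secondFundamentalForm_comp hG' hsymm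
        (hf.smooth.of_le (by norm_cast)) ν _ _).symm
    · rw [← pullback_apply, ← fderiv_comp_apply]
      exact hν u

end IsLocalIsometryAt

theorem HasMeanCurvatureVector.congr_of_eventuallyEq {g : E → E → E → ℝ} {k : ℕ}
    {f f' : (Fin k → ℝ) → E} {t : Fin k → ℝ} {η : E} (hf : HasMeanCurvatureVector g f t η)
    (hff' : f' =ᶠ[𝓝 t] f) : HasMeanCurvatureVector g f' t η where
  smooth := hf.smooth.congr_of_eventuallyEq hff'
  immersion := by simpa only [hff'.fderiv_eq] using hf.immersion
  normal := by simpa only [hff'.fderiv_eq, hff'.self_of_nhds] using hf.normal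
  trace := by
    simpa only [secondFundamentalForm, hff'.fderiv_eq, hff'.fderiv.fderiv_eq, hff'.self_of_nhds]
      using hf.trace

end LocalIsometry

section HermitianForm

variable {n : ℕ}

/-- The vector `(c, u)` of `ℂ^{1,n} = ℂ ⊕ ℂⁿ`. -/
def join (c : ℂ) (u : EuclideanSpace ℂ (Fin n)) : Fin (n + 1) → ℂ :=
  Fin.cons c u.ofLp

theorem join_zero (c : ℂ) (u : EuclideanSpace ℂ (Fin n)) : join c u 0 = c := rfl

theorem join_succ (c : ℂ) (u : EuclideanSpace ℂ (Fin n)) (i : Fin n) :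
    join c u i.succ = u i := rfl

theorem join_eta (x : Fin (n + 1) → ℂ) : join (x 0) (WithLp.toLp 2 (Fin.tail x)) = x :=
  Fin.cons_self_tail x

theorem join_add (c d : ℂ) (u v : EuclideanSpace ℂ (Fin n)) :
    join c u + join d v = join (c + d) (u + v) := by
  ext i
  cases i using Fin.cases <;> simp [join]

theorem smul_join (r c : ℂ) (u : EuclideanSpace ℂ (Fin n)) :
    r • join c u = join (r * c) (r • u) := by
  ext i
  cases i using Fin.cases <;> simp [join]

/-- The Hermitian form of signature `(1, n)` on `ℂ^{1,n}`, conjugate linear in the first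
argument. -/
def herm (x y : Fin (n + 1) → ℂ) : ℂ := star x ⬝ᵥ (form n *ᵥ y)

theorem herm_add_left (x x' y : Fin (n + 1) → ℂ) : herm (x + x') y = herm x y + herm x' y := by
  simp [herm, add_dotProduct]

theorem herm_add_right (x y y' : Fin (n + 1) → ℂ) : herm x (y + y') = herm x y + herm x y' := by
  simp [herm, Matrix.mulVec_add, dotProduct_add]

theorem herm_smul_left (c : ℂ) (x y : Fin (n + 1) → ℂ) :
    herm (c • x) y = starRingEnd ℂ c * herm x y := by
  simp [herm]

theorem herm_smul_right (c : ℂ) (x y : Fin (n + 1) → ℂ) : herm x (c • y) = c * herm x y := by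
  simp [herm, Matrix.mulVec_smul]

theorem herm_join (c d : ℂ) (u v : EuclideanSpace ℂ (Fin n)) :
    herm (join c u) (join d v) = inner ℂ u v - starRingEnd ℂ c * d := by
  simp [herm, join, form, dotProduct, Matrix.mulVec_diagonal, Fin.sum_univ_succ,
    PiLp.inner_apply, mul_comm, sub_eq_neg_add]

theorem herm_join_one_self (z : EuclideanSpace ℂ (Fin n)) :
    herm (join 1 z) (join 1 z) = ((‖z‖ ^ 2 - 1 : ℝ) : ℂ) := by
  simp [herm_join, inner_self_eq_norm_sq_to_K]

theorem herm_mulVec (g : SU n) (x y : Fin (n + 1) → ℂ) :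
    herm (g.1.1 *ᵥ x) (g.1.1 *ᵥ y) = herm x y := by
  have form_preserved : g.1.1ᴴ * form n * g.1.1 = form n := g.2
  unfold herm
  rw [Matrix.star_mulVec, ← Matrix.dotProduct_mulVec, Matrix.mulVec_mulVec, Matrix.mulVec_mulVec,
    form_preserved]

/-- The Hermitian metric, up to the factor `4`, that `ℂHⁿ` carries as a space of negative lines:
its value at the line of `ζ` on the projections of `x` and `y`. -/
def homogeneousMetric (ζ x y : Fin (n + 1) → ℂ) : ℂ :=
  (herm x ζ * herm ζ y - herm x y * herm ζ ζ) / herm ζ ζ ^ 2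

theorem homogeneousMetric_add_smul (ζ x y : Fin (n + 1) → ℂ) (c d : ℂ) :
    homogeneousMetric ζ (x + c • ζ) (y + d • ζ) = homogeneousMetric ζ x y := by
  simp only [homogeneousMetric, herm_add_left, herm_add_right, herm_smul_left, herm_smul_right]
  congr 1
  ring

theorem homogeneousMetric_smul (ζ x y : Fin (n + 1) → ℂ) {c : ℂ} (hc : c ≠ 0) :
    homogeneousMetric (c • ζ) (c • x) (c • y) = homogeneousMetric ζ x y := by
  have conj_ne_zero : starRingEnd ℂ c ≠ 0 := by simpa using hc
  simp only [homogeneousMetric, herm_smul_left, herm_smul_right]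
  by_cases hζ : herm ζ ζ = 0
  · simp [hζ]
  · field_simp

theorem homogeneousMetric_mulVec (g : SU n) (ζ x y : Fin (n + 1) → ℂ) :
    homogeneousMetric (g.1.1 *ᵥ ζ) (g.1.1 *ᵥ x) (g.1.1 *ᵥ y) = homogeneousMetric ζ x y := by
  simp only [homogeneousMetric, herm_mulVec]

theorem metric_eq_homogeneousMetric {z : EuclideanSpace ℂ (Fin n)} (hz : ‖z‖ < 1)
    (u v : EuclideanSpace ℂ (Fin n)) :
    metric z u v = 4 * (homogeneousMetric (join 1 z) (join 0 u) (join 0 v)).re := by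
  have one_sub_ne_zero : 1 - (‖z‖ : ℂ) ^ 2 ≠ 0 := by
    exact_mod_cast (by nlinarith [norm_nonneg z] : 1 - ‖z‖ ^ 2 ≠ 0)
  have sub_one_eq : ((‖z‖ ^ 2 - 1 : ℝ) : ℂ) = -(1 - (‖z‖ : ℂ) ^ 2) := by push_cast; ring
  rw [metric, homogeneousMetric, herm_join_one_self, sub_one_eq]
  simp only [herm_join, map_zero, mul_zero, zero_mul, sub_zero]
  congr 2
  field_simp
  ring

end HermitianForm

section Metric

variable {n : ℕ}

theorem metric_add_left (z u u' v : EuclideanSpace ℂ (Fin n)) :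
    metric z (u + u') v = metric z u v + metric z u' v := by
  simp only [metric, inner_add_left, ← mul_add, ← Complex.add_re]
  congr 2
  ring

theorem metric_smul_left (z u v : EuclideanSpace ℂ (Fin n)) (c : ℝ) :
    metric z (c • u) v = c * metric z u v := by
  have inner_smul (x : EuclideanSpace ℂ (Fin n)) : inner ℂ (c • u) x = (c : ℂ) * inner ℂ u x :=
    inner_smul_real_left u x c
  simp only [metric, inner_smul]
  rw [mul_left_comm c 4, ← Complex.re_ofReal_mul c]
  congr 2
  ring

theorem metric_comm (z u v : EuclideanSpace ℂ (Fin n)) : metric z u v = metric z v u := by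
  unfold metric
  rw [← Complex.conj_re]
  congr 2
  simp [mul_comm]

theorem metric_neg_base (z u v : EuclideanSpace ℂ (Fin n)) : metric (-z) u v = metric z u v := by
  simp [metric]

theorem metric_zero_base (u v : EuclideanSpace ℂ (Fin n)) :
    metric 0 u v = 4 * (inner ℂ u v).re := by
  simp [metric]

theorem metric_self_pos {z u : EuclideanSpace ℂ (Fin n)} (hz : ‖z‖ < 1) (hu : u ≠ 0) :
    0 < metric z u u := by
  have one_sub_pos : 0 < 1 - ‖z‖ ^ 2 := by nlinarith [norm_nonneg z]
  have metric_self :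
      metric z u u = 4 * (‖u‖ ^ 2 / (1 - ‖z‖ ^ 2) + ‖inner ℂ u z‖ ^ 2 / (1 - ‖z‖ ^ 2) ^ 2) := by
    have inner_self : inner ℂ u u = (‖u‖ : ℂ) ^ 2 := inner_self_eq_norm_sq_to_K u
    rw [metric, ← inner_conj_symm z u, Complex.mul_conj', inner_self]
    norm_cast
  have := norm_pos_iff.2 hu
  rw [metric_self]
  positivity

/-- The metric of `ℂHⁿ` as a family of continuous bilinear forms. -/
def metricForm (z : EuclideanSpace ℂ (Fin n)) :
    EuclideanSpace ℂ (Fin n) →L[ℝ] EuclideanSpace ℂ (Fin n) →L[ℝ] ℝ :=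
  LinearMap.toContinuousBilinearMap
    (LinearMap.mk₂ ℝ (metric z) (metric_add_left z) (fun c u v => metric_smul_left z u v c)
      (fun u v v' => by simp only [metric_comm z u, metric_add_left])
      (fun c u v => by simp only [metric_comm z u, metric_smul_left, smul_eq_mul]))

theorem metricForm_apply (z u v : EuclideanSpace ℂ (Fin n)) : metricForm z u v = metric z u v :=
  rfl

theorem contDiffOn_metric (u v : EuclideanSpace ℂ (Fin n)) :
    ContDiffOn ℝ ∞ (fun z => metric z u v) (Metric.ball 0 1) := by
  have contDiff_one_sub :
      ContDiff ℝ ∞ fun z : EuclideanSpace ℂ (Fin n) => 1 - (‖z‖ : ℂ) ^ 2 := by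
    simpa only [Function.comp_def, Complex.ofRealCLM_apply, Complex.ofReal_pow] using
      contDiff_const.sub (Complex.ofRealCLM.contDiff.comp (contDiff_norm_sq ℂ))
  have one_sub_ne_zero :
      ∀ z ∈ Metric.ball (0 : EuclideanSpace ℂ (Fin n)) 1, 1 - (‖z‖ : ℂ) ^ 2 ≠ 0 := by
    intro z hz
    have norm_lt_one : ‖z‖ < 1 := by simpa using hz
    exact_mod_cast (by nlinarith [norm_nonneg z] : 1 - ‖z‖ ^ 2 ≠ 0)
  have contDiff_inner_mul :
      ContDiff ℝ ∞ fun z : EuclideanSpace ℂ (Fin n) => inner ℂ u z * inner ℂ z v :=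
    (contDiff_const.inner ℂ contDiff_id).mul (contDiff_id.inner ℂ contDiff_const)
  simp only [metric, div_eq_mul_inv]
  refine contDiffOn_const.mul (Complex.reCLM.contDiff.comp_contDiffOn (ContDiffOn.add ?_ ?_))
  · exact contDiffOn_const.mul (contDiff_one_sub.contDiffOn.inv one_sub_ne_zero)
  · exact contDiff_inner_mul.contDiffOn.mul ((contDiff_one_sub.pow 2).contDiffOn.inv
      fun z hz => pow_ne_zero 2 (one_sub_ne_zero z hz))

theorem differentiableAt_metricForm {z : EuclideanSpace ℂ (Fin n)} (hz : ‖z‖ < 1) :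
    DifferentiableAt ℝ (metricForm (n := n)) z := by
  have contDiffOn_metricForm : ContDiffOn ℝ ∞ (metricForm (n := n)) (Metric.ball 0 1) :=
    contDiffOn_clm_apply.2 fun u => contDiffOn_clm_apply.2 fun v => contDiffOn_metric u v
  exact (contDiffOn_metricForm.contDiffAt
    (Metric.isOpen_ball.mem_nhds (by simpa using hz))).differentiableAt (by simp)

theorem fderiv_zero_eq_zero_of_even {E F : Type*} [NormedAddCommGroup E] [NormedSpace ℝ E]
    [NormedAddCommGroup F] [NormedSpace ℝ F] {f : E → F} (hf : f.Even) : fderiv ℝ f 0 = 0 := by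
  have fderiv_eq_neg : fderiv ℝ f 0 = -fderiv ℝ f 0 := by
    ext u
    have chain_rule :=
      DFunLike.congr_fun ((ContinuousLinearEquiv.neg ℝ).comp_right_fderiv (f := f) (x := 0)) u
    rw [show f ∘ ContinuousLinearEquiv.neg ℝ = f from funext hf] at chain_rule
    simpa using chain_rule
  rw [eq_neg_iff_add_eq_zero, ← two_smul ℝ] at fderiv_eq_neg
  exact (smul_eq_zero_iff_right two_ne_zero).1 fderiv_eq_neg

theorem christoffel_metric_zero (u v w : EuclideanSpace ℂ (Fin n)) :
    christoffel metric 0 u v w = 0 := by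
  have fderiv_metric_zero (u v : EuclideanSpace ℂ (Fin n)) :
      fderiv ℝ (fun z => metric z u v) 0 = 0 :=
    fderiv_zero_eq_zero_of_even fun z => metric_neg_base z u v
  simp [christoffel, fderiv_metric_zero]

end Metric

section Action

variable {n : ℕ}

/-- The column of `A` below its corner. For `A ∈ su(1,n)` this is the tangent vector at `o` of
`s ↦ exp(sA) · o`. -/
def tangent : Matrix (Fin (n + 1)) (Fin (n + 1)) ℂ →ₗ[ℝ] EuclideanSpace ℂ (Fin n) where
  toFun A := WithLp.toLp 2 fun i => A i.succ 0
  map_add' _ _ := rfl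
  map_smul' _ _ := rfl

theorem tangent_apply (A : Matrix (Fin (n + 1)) (Fin (n + 1)) ℂ) (i : Fin n) :
    tangent A i = A i.succ 0 := rfl

/-- The row of `A` to the right of its corner, as a linear form. -/
def topRow (A : Matrix (Fin (n + 1)) (Fin (n + 1)) ℂ) : EuclideanSpace ℂ (Fin n) →L[ℂ] ℂ :=
  innerSL ℂ (WithLp.toLp 2 fun i => star (A 0 i.succ))

/-- The block of `A` that remains when its first row and column are removed. -/
def lowerBlock (A : Matrix (Fin (n + 1)) (Fin (n + 1)) ℂ) :
    EuclideanSpace ℂ (Fin n) →L[ℂ] EuclideanSpace ℂ (Fin n) :=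
  Matrix.toEuclideanCLM (𝕜 := ℂ) (A.submatrix Fin.succ Fin.succ)

variable (A C : Matrix (Fin (n + 1)) (Fin (n + 1)) ℂ)

theorem mulVec_join (c : ℂ) (u : EuclideanSpace ℂ (Fin n)) :
    A *ᵥ join c u = join (c * A 0 0 + topRow A u) (c • tangent A + lowerBlock A u) := by
  ext i
  cases i using Fin.cases <;>
    simp [join, tangent_apply, topRow, lowerBlock, Matrix.mulVec, dotProduct, Fin.sum_univ_succ,
      PiLp.inner_apply, mul_comm]

theorem join_corner_tangent : join (A 0 0) (tangent A) = A *ᵥ join 1 0 := by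
  simp [mulVec_join]

variable {A C} {z : EuclideanSpace ℂ (Fin n)}

theorem act_eq_div :
    act A z = WithLp.toLp 2 fun i => (A *ᵥ join 1 z) i.succ / (A *ᵥ join 1 z) 0 := rfl

theorem act_eq_smul :
    act A z = (A 0 0 + topRow A z)⁻¹ • (tangent A + lowerBlock A z) := by
  ext i
  simp only [act_eq_div, mulVec_join, one_mul, one_smul, join_zero, join_succ, PiLp.smul_apply,
    smul_eq_mul, div_eq_inv_mul]

theorem act_one (z : EuclideanSpace ℂ (Fin n)) : act 1 z = z := by
  ext i
  simp [act_eq_div, join]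

theorem contDiffAt_act (hz : A 0 0 + topRow A z ≠ 0) : ContDiffAt ℝ ∞ (act A) z := by
  have complex_contDiffAt : ContDiffAt ℂ ∞
      (fun z => (A 0 0 + topRow A z)⁻¹ • (tangent A + lowerBlock A z)) z :=
    ((contDiffAt_const.add (topRow A).contDiff.contDiffAt).inv hz).smul
      (contDiffAt_const.add (lowerBlock A).contDiff.contDiffAt)
  rw [show act A = _ from funext fun _ => act_eq_smul]
  exact complex_contDiffAt.restrict_scalars ℝ

theorem fderiv_act_apply (hz : A 0 0 + topRow A z ≠ 0) (u : EuclideanSpace ℂ (Fin n)) :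
    fderiv ℝ (act A) z u =
      (A 0 0 + topRow A z)⁻¹ • (lowerBlock A u - topRow A u • act A z) := by
  have hasFDerivAt_denom : HasFDerivAt (𝕜 := ℝ) (fun y => A 0 0 + topRow A y)
      ((topRow A).restrictScalars ℝ) z :=
    ((topRow A).restrictScalars ℝ).hasFDerivAt.const_add _
  have hasFDerivAt_num : HasFDerivAt (𝕜 := ℝ) (fun y => tangent A + lowerBlock A y)
      ((lowerBlock A).restrictScalars ℝ) z :=
    ((lowerBlock A).restrictScalars ℝ).hasFDerivAt.const_add _
  have denom_smul_act : (fun y => (A 0 0 + topRow A y) • act A y) =ᶠ[𝓝 z]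
      fun y => tangent A + lowerBlock A y := by
    filter_upwards [hasFDerivAt_denom.continuousAt.eventually_ne hz] with y hy
    rw [act_eq_smul, smul_inv_smul₀ hy]
  have hasFDerivAt_act := ((contDiffAt_act hz).differentiableAt (by simp)).hasFDerivAt
  have leibniz := DFunLike.congr_fun ((hasFDerivAt_denom.smul hasFDerivAt_act).unique
    (hasFDerivAt_num.congr_of_eventuallyEq denom_smul_act)) u
  rw [eq_inv_smul_iff₀ hz, eq_sub_iff_add_eq]
  simpa using leibniz

theorem join_one_act (hz : A 0 0 + topRow A z ≠ 0) :
    join 1 (act A z) = (A 0 0 + topRow A z)⁻¹ • (A *ᵥ join 1 z) := by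
  rw [mulVec_join, smul_join, one_mul, one_smul, inv_mul_cancel₀ hz, act_eq_smul]

theorem join_zero_fderiv_act (hz : A 0 0 + topRow A z ≠ 0) (u : EuclideanSpace ℂ (Fin n)) :
    join 0 (fderiv ℝ (act A) z u) = (A 0 0 + topRow A z)⁻¹ • (A *ᵥ join 0 u
      + (-(topRow A u / (A 0 0 + topRow A z))) • (A *ᵥ join 1 z)) := by
  rw [fderiv_act_apply hz, act_eq_smul, mulVec_join, mulVec_join, smul_join, join_add, smul_join]
  congr 1
  · field_simp
    ring
  · module

theorem act_mul (hz : C 0 0 + topRow C z ≠ 0) : act (A * C) z = act A (act C z) := by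
  ext i
  simp only [act_eq_div (A := A), act_eq_div (A := A * C), join_one_act hz, Matrix.mulVec_smul,
    Matrix.mulVec_mulVec, Pi.smul_apply, smul_eq_mul]
  rw [mul_div_mul_left _ _ (inv_ne_zero hz)]

theorem corner_add_topRow_ne_zero (g : SU n) (hz : ‖z‖ < 1) :
    g.1.1 0 0 + topRow g.1.1 z ≠ 0 := by
  intro denom_eq_zero
  have herm_preserved := herm_mulVec g (join 1 z) (join 1 z)
  rw [mulVec_join, one_mul, denom_eq_zero, herm_join_one_self, herm_join,
    inner_self_eq_norm_sq_to_K] at herm_preserved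
  have norm_sq_eq : ‖(1 : ℂ) • tangent g.1.1 + lowerBlock g.1.1 z‖ ^ 2 = ‖z‖ ^ 2 - 1 :=
    Complex.ofReal_injective (by simpa using herm_preserved)
  nlinarith [norm_nonneg z, sq_nonneg ‖(1 : ℂ) • tangent g.1.1 + lowerBlock g.1.1 z‖]

theorem norm_act_lt_one (g : SU n) (hz : ‖z‖ < 1) : ‖act g.1.1 z‖ < 1 := by
  set q := g.1.1 0 0 + topRow g.1.1 z with hq
  have q_ne_zero : q ≠ 0 := corner_add_topRow_ne_zero g hz
  have herm_act : ‖act g.1.1 z‖ ^ 2 - 1 = ‖q⁻¹‖ ^ 2 * (‖z‖ ^ 2 - 1) := by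
    have herm_act := herm_join_one_self (act g.1.1 z)
    rw [join_one_act q_ne_zero, herm_smul_left, herm_smul_right, herm_mulVec, herm_join_one_self,
      ← mul_assoc, Complex.conj_mul', ← hq] at herm_act
    exact_mod_cast herm_act.symm
  have factor_pos : 0 < ‖q⁻¹‖ ^ 2 := pow_pos (norm_pos_iff.2 (inv_ne_zero q_ne_zero)) 2
  have norm_sq_lt_one : ‖z‖ ^ 2 - 1 < 0 := by nlinarith [norm_nonneg z]
  nlinarith [mul_neg_of_pos_of_neg factor_pos norm_sq_lt_one]

theorem metric_act (g : SU n) (hz : ‖z‖ < 1) (u v : EuclideanSpace ℂ (Fin n)) :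
    metric (act g.1.1 z) (fderiv ℝ (act g.1.1) z u) (fderiv ℝ (act g.1.1) z v) =
      metric z u v := by
  have denom_ne_zero := corner_add_topRow_ne_zero g hz
  rw [metric_eq_homogeneousMetric (norm_act_lt_one g hz), metric_eq_homogeneousMetric hz,
    join_one_act denom_ne_zero, join_zero_fderiv_act denom_ne_zero,
    join_zero_fderiv_act denom_ne_zero, homogeneousMetric_smul _ _ _ (inv_ne_zero denom_ne_zero),
    homogeneousMetric_add_smul, homogeneousMetric_mulVec]

theorem isLocalIsometryAt_act (g : SU n) (hz : ‖z‖ < 1) :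
    IsLocalIsometryAt metricForm metricForm (act g.1.1) z := by
  have injective : Function.Injective (fderiv ℝ (act g.1.1) z) := by
    refine (injective_iff_map_eq_zero _).2 fun u hu => ?_
    by_contra u_ne_zero
    have preserved := metric_act g hz u u
    rw [hu, ← metricForm_apply, map_zero] at preserved
    exact (metric_self_pos hz u_ne_zero).ne preserved
  have surjective : Function.Surjective (fderiv ℝ (act g.1.1) z) :=
    (fderiv ℝ (act g.1.1) z).toLinearMap.injective_iff_surjective.1 injective
  refine ⟨contDiffAt_act (corner_add_topRow_ne_zero g hz),
    ⟨injective, surjective⟩, ?_⟩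
  filter_upwards [continuous_norm.continuousAt.eventually_lt continuousAt_const hz] with y hy
  exact metric_act g hy

end Action

section Exponential

theorem hasDerivAt_linearMap_exp_smul {m F : Type*} [Fintype m] [DecidableEq m]
    [NormedAddCommGroup F] [NormedSpace ℝ F] (L : Matrix m m ℂ →ₗ[ℝ] F) (A : Matrix m m ℂ)
    (s : ℝ) :
    HasDerivAt (fun s : ℝ => L (NormedSpace.exp (s • A))) (L (A * NormedSpace.exp (s • A))) s := by
  let _ : NormedRing (Matrix m m ℂ) := Matrix.linftyOpNormedRing
  let _ : NormedAlgebra ℝ (Matrix m m ℂ) := Matrix.linftyOpNormedAlgebra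
  exact L.toContinuousLinearMap.hasFDerivAt.comp_hasDerivAt s
    (hasDerivAt_exp_smul_const' (𝕂 := ℝ) A s)

theorem contDiff_linearMap_exp {m V F : Type*} [Fintype m] [DecidableEq m]
    [NormedAddCommGroup V] [NormedSpace ℝ V] [FiniteDimensional ℝ V]
    [NormedAddCommGroup F] [NormedSpace ℝ F] (L : Matrix m m ℂ →ₗ[ℝ] F)
    (Φ : V →ₗ[ℝ] Matrix m m ℂ) : ContDiff ℝ ∞ fun t => L (NormedSpace.exp (Φ t)) := by
  let _ : NormedRing (Matrix m m ℂ) := Matrix.linftyOpNormedRing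
  let _ : NormedAlgebra ℝ (Matrix m m ℂ) := Matrix.linftyOpNormedAlgebra
  have contDiff_exp : ContDiff ℝ ∞ (NormedSpace.exp : Matrix m m ℂ → Matrix m m ℂ) :=
    contDiff_iff_contDiffAt.2 fun A => (NormedSpace.exp_analytic (𝕂 := ℝ) A).contDiffAt
  exact L.toContinuousLinearMap.contDiff.comp
    (contDiff_exp.comp (LinearMap.toContinuousLinearMap Φ).contDiff)

variable {n : ℕ} (A C : Matrix (Fin (n + 1)) (Fin (n + 1)) ℂ)

theorem join_corner_tangent_mul :
    join ((A * C) 0 0) (tangent (A * C)) = A *ᵥ join (C 0 0) (tangent C) := by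
  rw [join_corner_tangent, join_corner_tangent, Matrix.mulVec_mulVec]

theorem corner_mul : (A * C) 0 0 = C 0 0 * A 0 0 + topRow A (tangent C) := by
  have := congrFun (join_corner_tangent_mul A C) 0
  rwa [mulVec_join] at this

theorem tangent_mul : tangent (A * C) = C 0 0 • tangent A + lowerBlock A (tangent C) := by
  ext i
  have := congrFun (join_corner_tangent_mul A C) i.succ
  rwa [mulVec_join] at this

theorem act_zero : act C 0 = (C 0 0)⁻¹ • tangent C := by
  rw [act_eq_smul, map_zero, map_zero, add_zero, add_zero]

theorem eventually_exp_corner_ne_zero {V : Type*} [NormedAddCommGroup V] [NormedSpace ℝ V]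
    [FiniteDimensional ℝ V] (Φ : V →ₗ[ℝ] Matrix (Fin (n + 1)) (Fin (n + 1)) ℂ) :
    ∀ᶠ t in 𝓝 0, NormedSpace.exp (Φ t) 0 0 ≠ 0 :=
  (contDiff_linearMap_exp (Matrix.entryLinearMap ℝ ℂ 0 0) Φ).continuous.continuousAt.eventually_ne
    (by simp [NormedSpace.exp_zero])

/-- The vector field on the ball that the action by fractional linear maps associates with `A`:
its integral curves are `s ↦ exp(sA) · z`. -/
def actionField (z : EuclideanSpace ℂ (Fin n)) : EuclideanSpace ℂ (Fin n) :=
  tangent A + lowerBlock A z - (A 0 0 + topRow A z) • z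

/-- The acceleration at `s = 0` of the curve `s ↦ exp(sA) · o`. As the Christoffel symbols of
`metric` vanish at `o`, it is also the covariant acceleration there. -/
def acceleration : EuclideanSpace ℂ (Fin n) :=
  lowerBlock A (tangent A) - A 0 0 • tangent A

theorem actionField_zero : actionField A 0 = tangent A := by
  simp [actionField]

variable {A} in
theorem hasDerivAt_act_exp {s : ℝ} (hs : NormedSpace.exp (s • A) 0 0 ≠ 0) :
    HasDerivAt (fun s : ℝ => act (NormedSpace.exp (s • A)) 0)
      (actionField A (act (NormedSpace.exp (s • A)) 0)) s := by
  have hasDerivAt_corner := hasDerivAt_linearMap_exp_smul (Matrix.entryLinearMap ℝ ℂ 0 0) A s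
  have hasDerivAt_tangent := hasDerivAt_linearMap_exp_smul tangent A s
  simp only [Matrix.entryLinearMap_apply] at hasDerivAt_corner
  simp only [act_zero]
  refine ((hasDerivAt_corner.inv hs).smul hasDerivAt_tangent).congr_deriv ?_
  rw [tangent_mul, corner_mul, actionField, map_smul, map_smul, smul_eq_mul, Pi.inv_apply]
  match_scalars <;> field_simp

theorem hasDerivAt_act_exp_zero :
    HasDerivAt (fun s : ℝ => act (NormedSpace.exp (s • A)) 0) (tangent A) 0 := by
  have := hasDerivAt_act_exp (A := A) (s := 0) (by simp [NormedSpace.exp_zero])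
  rwa [zero_smul, NormedSpace.exp_zero, act_one, actionField_zero] at this

theorem hasDerivAt_actionField_act_exp_zero :
    HasDerivAt (fun s : ℝ => actionField A (act (NormedSpace.exp (s • A)) 0)) (acceleration A)
      0 := by
  have hasDerivAt_act := hasDerivAt_act_exp_zero A
  have hasDerivAt_topRow :=
    ((topRow A).restrictScalars ℝ).hasFDerivAt.comp_hasDerivAt (0 : ℝ) hasDerivAt_act
  have hasDerivAt_lowerBlock :=
    ((lowerBlock A).restrictScalars ℝ).hasFDerivAt.comp_hasDerivAt (0 : ℝ) hasDerivAt_act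
  refine ((hasDerivAt_lowerBlock.const_add (tangent A)).sub
    ((hasDerivAt_topRow.const_add (A 0 0)).smul hasDerivAt_act)).congr_deriv ?_
  simp [act_one, acceleration]

theorem fderiv_fderiv_apply_self {E F : Type*} [NormedAddCommGroup E] [NormedSpace ℝ E]
    [NormedAddCommGroup F] [NormedSpace ℝ F] {f : E → F} {p u : E} (hf : ContDiffAt ℝ 2 f p)
    {f' : ℝ → F} {f'' : F} (hf' : ∀ᶠ s : ℝ in 𝓝 0, HasDerivAt (fun s : ℝ => f (p + s • u)) (f' s) s)
    (hf'' : HasDerivAt f' f'' 0) : fderiv ℝ (fderiv ℝ f) p u u = f'' := by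
  have hasDerivAt_line (s : ℝ) : HasDerivAt (fun s : ℝ => p + s • u) u s := by
    simpa using ((hasDerivAt_id s).smul_const u).const_add p
  have tendsto_line : Tendsto (fun s : ℝ => p + s • u) (𝓝 0) (𝓝 p) := by
    simpa using (hasDerivAt_line 0).continuousAt.tendsto
  have f'_eventually_eq : f' =ᶠ[𝓝 0] fun s : ℝ => fderiv ℝ f (p + s • u) u := by
    filter_upwards [hf', tendsto_line.eventually (hf.eventually (by simp))] with s hs hfs
    exact hs.unique
      ((hfs.differentiableAt two_ne_zero).hasFDerivAt.comp_hasDerivAt s (hasDerivAt_line s))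
  have hasDerivAt_fderiv :
      HasDerivAt (fun s : ℝ => fderiv ℝ f (p + s • u)) (fderiv ℝ (fderiv ℝ f) p u) 0 :=
    HasFDerivAt.comp_hasDerivAt (l := fderiv ℝ f) (0 : ℝ)
      (by simpa using (differentiableAt_fderiv hf).hasFDerivAt) (hasDerivAt_line 0)
  simpa using (hasDerivAt_fderiv.clm_apply (hasDerivAt_const (0 : ℝ) u)).unique
    (hf''.congr_of_eventuallyEq f'_eventually_eq.symm)

theorem leftInvariantVector_eq (g : SU n) (Y : su n) :
    leftInvariantVector g Y = fderiv ℝ (act g.1.1) 0 (tangent Y.1) := by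
  have act_mul_eventually :
      (fun s : ℝ => act (g.1.1 * NormedSpace.exp (s • Y.1)) (basePoint n)) =ᶠ[𝓝 0]
        fun s => act g.1.1 (act (NormedSpace.exp (s • Y.1)) 0) := by
    filter_upwards [eventually_exp_corner_ne_zero (LinearMap.toSpanSingleton ℝ _ Y.1)] with s hs
    exact act_mul (by simpa [basePoint] using hs)
  have differentiableAt_act : DifferentiableAt ℝ (act g.1.1) 0 :=
    (isLocalIsometryAt_act g (by simp)).contDiffAt.differentiableAt (by simp)
  have hasDerivAt_comp := HasFDerivAt.comp_hasDerivAt (l := act g.1.1) (0 : ℝ)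
    (by simpa [act_one] using differentiableAt_act.hasFDerivAt) (hasDerivAt_act_exp_zero Y.1)
  exact (hasDerivAt_comp.congr_of_eventuallyEq act_mul_eventually).deriv

theorem leftInvariantVector_one (Y : su n) : leftInvariantVector 1 Y = tangent Y.1 := by
  simpa [leftInvariantVector, basePoint] using (hasDerivAt_act_exp_zero Y.1).deriv

theorem innerAN_eq (Y Y' : su n) : innerAN Y Y' = metric 0 (tangent Y.1) (tangent Y'.1) := by
  rw [innerAN, leftInvariantVector_one, leftInvariantVector_one, basePoint]

end Exponential

section Orbit

variable {n : ℕ}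

section ExpChart

variable {V : Type*} [NormedAddCommGroup V] [NormedSpace ℝ V] [FiniteDimensional ℝ V]

/-- The map `t ↦ exp(Φ t) · o`. With coordinates `Φ` on the Lie algebra of a group it is an
exponential chart of the orbit of the group through `o`. -/
def expChart (Φ : V →ₗ[ℝ] Matrix (Fin (n + 1)) (Fin (n + 1)) ℂ) (t : V) :
    EuclideanSpace ℂ (Fin n) :=
  act (NormedSpace.exp (Φ t)) 0

variable (Φ : V →ₗ[ℝ] Matrix (Fin (n + 1)) (Fin (n + 1)) ℂ)

omit [FiniteDimensional ℝ V] in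
theorem expChart_zero : expChart Φ 0 = 0 := by
  rw [expChart, map_zero, NormedSpace.exp_zero, act_one]

theorem contDiffAt_expChart : ContDiffAt ℝ ∞ (expChart Φ) 0 := by
  unfold expChart
  simp only [act_zero]
  exact ((contDiff_linearMap_exp (Matrix.entryLinearMap ℝ ℂ 0 0) Φ).contDiffAt.inv
    (by simp [NormedSpace.exp_zero])).smul (contDiff_linearMap_exp tangent Φ).contDiffAt

theorem fderiv_expChart_apply (u : V) : fderiv ℝ (expChart Φ) 0 u = tangent (Φ u) := by
  have hasDerivAt_line : HasDerivAt (fun s : ℝ => s • u) u 0 := by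
    simpa using (hasDerivAt_id (0 : ℝ)).smul_const u
  have hasDerivAt_expChart : HasDerivAt (fun s : ℝ => expChart Φ (s • u)) (tangent (Φ u)) 0 := by
    simpa only [expChart, map_smul] using hasDerivAt_act_exp_zero (Φ u)
  refine (HasFDerivAt.comp_hasDerivAt (l := expChart Φ) (0 : ℝ) ?_ hasDerivAt_line).unique
    hasDerivAt_expChart
  simpa using ((contDiffAt_expChart Φ).differentiableAt (by simp)).hasFDerivAt

theorem fderiv_fderiv_expChart_apply_self (u : V) :
    fderiv ℝ (fderiv ℝ (expChart Φ)) 0 u u = acceleration (Φ u) := by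
  refine fderiv_fderiv_apply_self ((contDiffAt_expChart Φ).of_le (by norm_cast)) ?_
    (hasDerivAt_actionField_act_exp_zero (Φ u))
  filter_upwards [eventually_exp_corner_ne_zero (LinearMap.toSpanSingleton ℝ _ (Φ u))] with s hs
  simp only [expChart, zero_add, map_smul]
  exact hasDerivAt_act_exp hs

theorem secondFundamentalForm_expChart {k : ℕ}
    (Φ : (Fin k → ℝ) →ₗ[ℝ] Matrix (Fin (n + 1)) (Fin (n + 1)) ℂ) (ν : EuclideanSpace ℂ (Fin n))
    (u : Fin k → ℝ) :
    secondFundamentalForm metric (expChart Φ) 0 ν u u = metric 0 (acceleration (Φ u)) ν := by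
  rw [secondFundamentalForm, expChart_zero, christoffel_metric_zero,
    fderiv_fderiv_expChart_apply_self, add_zero]

end ExpChart

variable {𝔥 : LieSubalgebra ℝ (su n)} {Y : su n} {k : ℕ}

/-- The matrix in `𝔥` with given coordinates in a basis of `𝔥`. -/
def matrixOfCoords (v : Module.Basis (Fin k) ℝ 𝔥) :
    (Fin k → ℝ) →ₗ[ℝ] Matrix (Fin (n + 1)) (Fin (n + 1)) ℂ :=
  (su n).toSubmodule.subtype ∘ₗ 𝔥.toSubmodule.subtype ∘ₗ v.equivFun.symm.toLinearMap

theorem matrixOfCoords_apply (v : Module.Basis (Fin k) ℝ 𝔥) (u : Fin k → ℝ) :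
    matrixOfCoords v u = (v.equivFun.symm u).1.1 := rfl

theorem matrixOfCoords_equivFun (v : Module.Basis (Fin k) ℝ 𝔥) (X : 𝔥) :
    matrixOfCoords v (v.equivFun X) = X.1.1 := by
  rw [matrixOfCoords_apply, LinearEquiv.symm_apply_apply]

theorem orbitMap_eventuallyEq (v : Module.Basis (Fin k) ℝ 𝔥) (g : SU n) :
    orbitMap v g =ᶠ[𝓝 0] act g.1.1 ∘ expChart (matrixOfCoords v) := by
  filter_upwards [eventually_exp_corner_ne_zero (matrixOfCoords v)] with t ht
  have matrixOfCoords_eq_sum : matrixOfCoords v t = ∑ i, t i • (v i).1.1 := by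
    simp [matrixOfCoords_apply, Module.Basis.equivFun_symm_apply]
  rw [orbitMap, ← matrixOfCoords_eq_sum]
  exact act_mul (by simpa [basePoint] using ht)

theorem orbitHasMeanCurvature_of_expChart
    (h : ∀ (k : ℕ) (v : Module.Basis (Fin k) ℝ 𝔥),
      HasMeanCurvatureVector metric (expChart (matrixOfCoords v)) 0 (tangent Y.1)) :
    OrbitHasMeanCurvature 𝔥 Y := by
  intro g _ k v
  have isLocalIsometryAt : IsLocalIsometryAt metricForm metricForm (act g.1.1)
      (expChart (matrixOfCoords v) 0) :=
    isLocalIsometryAt_act g (by simp [expChart_zero])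
  have differentiableAt : DifferentiableAt ℝ (metricForm (n := n))
      (act g.1.1 (expChart (matrixOfCoords v) 0)) :=
    differentiableAt_metricForm (norm_act_lt_one g (by simp [expChart_zero]))
  have hasMeanCurvatureVector_act := isLocalIsometryAt.hasMeanCurvatureVector_comp
    differentiableAt (metric_comm _) (h k v)
  rw [expChart_zero, ← leftInvariantVector_eq] at hasMeanCurvatureVector_act
  exact hasMeanCurvatureVector_act.congr_of_eventuallyEq (orbitMap_eventuallyEq v g)

/-- Orthonormality for `innerAN`. -/
def OrthonormalAN {ι : Type*} [DecidableEq ι] (A : ι → su n) : Prop :=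
  ∀ i j, innerAN (A i) (A j) = if i = j then 1 else 0

variable {ι : Type*} [DecidableEq ι] {A : ι → su n}

theorem OrthonormalAN.linearIndependent_tangent (hA : OrthonormalAN A) :
    LinearIndependent ℝ fun i => tangent (A i).1 := by
  have metricForm_tangent (i j : ι) :
      (metricForm 0).toLinearMap₁₂ (tangent (A i).1) (tangent (A j).1) = if i = j then 1 else 0 :=
    (innerAN_eq _ _).symm.trans (hA i j)
  refine LinearMap.linearIndependent_of_isOrthoᵢ (B := (metricForm 0).toLinearMap₁₂)
    (fun i j hij => (metricForm_tangent i j).trans (if_neg hij)) fun i => ?_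
  rw [metricForm_tangent, if_pos rfl]
  exact one_ne_zero

theorem OrthonormalAN.eq_zero_of_tangent_eq_zero (hA : OrthonormalAN A) {X : su n}
    (hX : X ∈ Submodule.span ℝ (Set.range A)) (tangent_eq_zero : tangent X.1 = 0) : X = 0 :=
  Submodule.disjoint_def.1 (Submodule.range_ker_disjoint
    (f := tangent ∘ₗ (su n).toSubmodule.subtype) hA.linearIndependent_tangent) X hX tangent_eq_zero

theorem OrthonormalAN.linearIndependent (hA : OrthonormalAN A) : LinearIndependent ℝ A :=
  LinearIndependent.of_comp (tangent ∘ₗ (su n).toSubmodule.subtype) hA.linearIndependent_tangent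

omit [DecidableEq ι] in
theorem metric_tangent_eq_zero_of_mem_span {u : EuclideanSpace ℂ (Fin n)}
    (hu : ∀ i, metric 0 u (tangent (A i).1) = 0) {X : su n}
    (hX : X ∈ Submodule.span ℝ (Set.range A)) : metric 0 u (tangent X.1) = 0 := by
  have span_le_ker : Submodule.span ℝ (Set.range A) ≤
      LinearMap.ker ((metricForm 0 u).toLinearMap ∘ₗ tangent ∘ₗ (su n).toSubmodule.subtype) :=
    Submodule.span_le.2 (Set.range_subset_iff.2 hu)
  exact span_le_ker hX

theorem orbitHasMeanCurvature_of_orthonormalAN [Fintype ι] (hA : OrthonormalAN A)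
    (hspan : Submodule.span ℝ (Set.range A) = 𝔥.toSubmodule)
    (hY : ∀ i, innerAN Y (A i) = 0)
    (htrace : ∀ ν, (∀ i, metric 0 ν (tangent (A i).1) = 0) →
      metric 0 (tangent Y.1) ν = metric 0 (∑ i, acceleration (A i).1) ν) :
    OrbitHasMeanCurvature 𝔥 Y := by
  refine orbitHasMeanCurvature_of_expChart fun k v => ?_
  have mem_span (X : 𝔥) : X.1 ∈ Submodule.span ℝ (Set.range A) := hspan ▸ X.2
  let basisA : Module.Basis ι ℝ 𝔥 :=
    (Module.Basis.span hA.linearIndependent).map (LinearEquiv.ofEq _ _ hspan)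
  have basisA_apply (i : ι) : (basisA i).1 = A i := by
    rw [Module.Basis.map_apply, LinearEquiv.coe_ofEq_apply, Module.Basis.span_apply]
  let σ : Fin k ≃ ι := v.indexEquiv basisA
  let e (i : Fin k) : Fin k → ℝ := v.equivFun (basisA (σ i))
  have matrix_e (i : Fin k) : matrixOfCoords v (e i) = (A (σ i)).1 := by
    rw [matrixOfCoords_equivFun, basisA_apply]
  refine ⟨contDiffAt_expChart _, ?_, fun u => ?_, e, fun i j => ?_, fun ν hν => ?_⟩
  · refine (injective_iff_map_eq_zero _).2 fun u hu => ?_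
    rw [fderiv_expChart_apply] at hu
    exact v.equivFun.symm.map_eq_zero_iff.1
      (Subtype.ext (hA.eq_zero_of_tangent_eq_zero (mem_span (v.equivFun.symm u)) hu))
  · rw [expChart_zero, fderiv_expChart_apply]
    exact metric_tangent_eq_zero_of_mem_span (fun i => innerAN_eq Y (A i) ▸ hY i) (mem_span _)
  · rw [expChart_zero, fderiv_expChart_apply, fderiv_expChart_apply, matrix_e, matrix_e,
      ← innerAN_eq, hA]
    simp
  · have normal_to_basis (i : ι) : metric 0 ν (tangent (A i).1) = 0 := by
      simpa [expChart_zero, fderiv_expChart_apply, matrix_e] using hν (e (σ.symm i))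
    rw [expChart_zero, htrace ν normal_to_basis, ← σ.sum_comp, ← metricForm_apply, map_sum,
      sum_apply]
    simp only [metricForm_apply, secondFundamentalForm_expChart, matrix_e]

end Orbit

section RootSpaces

variable {n : ℕ}

theorem herm_mulVec_left_of_su (A : su n) (x y : Fin (n + 1) → ℂ) :
    herm (A.1 *ᵥ x) y = -herm x (A.1 *ᵥ y) := by
  rw [herm, herm, Matrix.star_mulVec, ← Matrix.dotProduct_mulVec, Matrix.mulVec_mulVec,
    Matrix.mulVec_mulVec, eq_neg_of_add_eq_zero_left A.2.1, Matrix.neg_mulVec, dotProduct_neg]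

theorem topRow_apply_of_su (A : su n) (u : EuclideanSpace ℂ (Fin n)) :
    topRow A.1 u = inner ℂ (tangent A.1) u := by
  have := herm_mulVec_left_of_su A (join 1 0) (join 0 u)
  simpa [mulVec_join, herm_join] using this.symm

theorem cartanP_apply_mul_add {B : su n} (hB : B ∈ cartanP n) (i j : Fin (n + 1)) :
    B.1 i j * (form n j j + form n i i) = 0 := by
  have conjTranspose_eq : B.1ᴴ = B.1 := hB
  have := congrFun (congrFun B.2.1 i) j
  rw [conjTranspose_eq] at this
  simpa [form, Matrix.mul_diagonal, Matrix.diagonal_mul, mul_add, mul_comm] using this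

variable {A B : su n} {c : ℝ}

theorem corner_of_mem_cartanP (hB : B ∈ cartanP n) : B.1 0 0 = 0 := by
  have := cartanP_apply_mul_add hB 0 0
  simpa [form] using this

theorem lowerBlock_of_mem_cartanP (hB : B ∈ cartanP n) : lowerBlock B.1 = 0 := by
  have submatrix_eq_zero : B.1.submatrix Fin.succ Fin.succ = 0 := by
    ext i j
    have := cartanP_apply_mul_add hB i.succ j.succ
    simpa [form] using this
  rw [lowerBlock, submatrix_eq_zero, map_zero]

theorem mulVec_join_of_mem_cartanP (hB : B ∈ cartanP n) (d : ℂ)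
    (u : EuclideanSpace ℂ (Fin n)) :
    B.1 *ᵥ join d u = join (inner ℂ (tangent B.1) u) (d • tangent B.1) := by
  rw [mulVec_join, corner_of_mem_cartanP hB, lowerBlock_of_mem_cartanP hB, topRow_apply_of_su,
    mul_zero, zero_add, zero_apply, add_zero]

theorem mem_rootSpace : A ∈ rootSpace B c ↔ ⁅B, A⁆ = c • A := by
  rw [rootSpace, Module.End.mem_eigenspace_iff, LieAlgebra.ad_apply]

theorem mulVec_mulVec_of_mem_rootSpace (hA : A ∈ rootSpace B c)
    (x : Fin (n + 1) → ℂ) :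
    B.1 *ᵥ (A.1 *ᵥ x) = A.1 *ᵥ (B.1 *ᵥ x) + (c : ℂ) • (A.1 *ᵥ x) := by
  have lie_eq : B.1 * A.1 - A.1 * B.1 = c • A.1 := congrArg Subtype.val (mem_rootSpace.1 hA)
  rw [Matrix.mulVec_mulVec, Matrix.mulVec_mulVec, eq_add_of_sub_eq' lie_eq, Matrix.add_mulVec,
    Matrix.smul_mulVec, Complex.coe_smul]

theorem rootSpace_corner (hB : B ∈ cartanP n) (hA : A ∈ rootSpace B c) :
    c * A.1 0 0 = inner ℂ (tangent B.1) (tangent A.1) - inner ℂ (tangent A.1) (tangent B.1) := by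
  have := congrFun (mulVec_mulVec_of_mem_rootSpace hA (join 1 0)) 0
  simp only [mulVec_join_of_mem_cartanP hB, mulVec_join A.1, topRow_apply_of_su, join_zero,
    Pi.add_apply, Pi.smul_apply, smul_eq_mul, one_mul, one_smul, map_zero, inner_zero_right,
    zero_mul, zero_add, add_zero] at this
  exact (sub_eq_of_eq_add' this).symm

theorem rootSpace_lowerBlock (hB : B ∈ cartanP n) (hA : A ∈ rootSpace B c)
    (u : EuclideanSpace ℂ (Fin n)) :
    (c : ℂ) • lowerBlock A.1 u = inner ℂ (tangent A.1) u • tangent B.1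
      - inner ℂ (tangent B.1) u • tangent A.1 := by
  ext i
  have := congrFun (mulVec_mulVec_of_mem_rootSpace hA (join 0 u)) i.succ
  simp only [mulVec_join_of_mem_cartanP hB, mulVec_join A.1, topRow_apply_of_su, join_succ,
    Pi.add_apply, Pi.smul_apply, zero_mul, zero_smul, map_zero, zero_add, add_zero] at this
  exact (sub_eq_of_eq_add' this).symm

theorem rootSpace_tangent (hB : B ∈ cartanP n) (hA : A ∈ rootSpace B c) :
    (c : ℂ) • tangent A.1 = A.1 0 0 • tangent B.1 - lowerBlock A.1 (tangent B.1) := by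
  ext i
  have := congrFun (mulVec_mulVec_of_mem_rootSpace hA (join 1 0)) i.succ
  simp only [mulVec_join_of_mem_cartanP hB, mulVec_join A.1, join_succ, Pi.add_apply,
    Pi.smul_apply, one_mul, one_smul, inner_zero_right, zero_smul, map_zero, zero_add,
    add_zero] at this
  exact (sub_eq_of_eq_add' this).symm

theorem eq_zero_of_tangent_eq_zero (hB : B ∈ cartanP n) (hA : A ∈ rootSpace B c) (hc : c ≠ 0)
    (tangent_eq_zero : tangent A.1 = 0) : A = 0 := by
  have hc' : (c : ℂ) ≠ 0 := Complex.ofReal_ne_zero.2 hc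
  have corner_eq_zero : A.1 0 0 = 0 := by
    simpa [tangent_eq_zero, hc'] using rootSpace_corner hB hA
  have lowerBlock_apply_eq_zero (u) : lowerBlock A.1 u = 0 := by
    simpa [tangent_eq_zero, hc] using rootSpace_lowerBlock hB hA u
  refine Subtype.ext (Matrix.ext_of_mulVec_single fun i => ?_)
  rw [← join_eta (Pi.single i 1), mulVec_join, corner_eq_zero, tangent_eq_zero,
    lowerBlock_apply_eq_zero, topRow_apply_of_su, tangent_eq_zero, inner_zero_left, smul_zero,
    mul_zero, add_zero, add_zero, ZeroMemClass.coe_zero, Matrix.zero_mulVec]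
  exact join_eta 0

theorem inner_tangent_self (A : su n) :
    inner ℂ (tangent A.1) (tangent A.1) = (innerAN A A : ℂ) / 4 := by
  have ofReal_re : ((inner ℂ (tangent A.1) (tangent A.1)).re : ℂ) =
      inner ℂ (tangent A.1) (tangent A.1) := inner_self_ofReal_re _
  rw [innerAN_eq, metric_zero_base, Complex.ofReal_mul, ofReal_re, Complex.ofReal_ofNat]
  ring

theorem inner_tangent_self_of_unit (hB1 : innerAN B B = 1) :
    inner ℂ (tangent B.1) (tangent B.1) = (1 / 4 : ℂ) := by
  rw [inner_tangent_self, hB1, Complex.ofReal_one]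

theorem rootSpace_smul_tangent (hB : B ∈ cartanP n) (hB1 : innerAN B B = 1)
    (hA : A ∈ rootSpace B c) :
    ((c : ℂ) ^ 2 - 1 / 4) • tangent A.1 = (inner ℂ (tangent B.1) (tangent A.1)
      - 2 * inner ℂ (tangent A.1) (tangent B.1)) • tangent B.1 := by
  have smul_smul_tangent := congrArg ((c : ℂ) • ·) (rootSpace_tangent hB hA)
  simp only [smul_sub, smul_smul, rootSpace_corner hB hA, rootSpace_lowerBlock hB hA,
    inner_tangent_self_of_unit hB1] at smul_smul_tangent
  rw [sub_smul, pow_two, smul_smul_tangent]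
  module

theorem sq_mul_inner_tangent (hB : B ∈ cartanP n) (hB1 : innerAN B B = 1)
    (hA : A ∈ rootSpace B c) :
    ((c ^ 2 : ℝ) : ℂ) * inner ℂ (tangent B.1) (tangent A.1) =
      (inner ℂ (tangent B.1) (tangent A.1)).im * Complex.I := by
  have inner_eq := congrArg (inner ℂ (tangent B.1)) (rootSpace_smul_tangent hB hB1 hA)
  rw [inner_smul_right, inner_smul_right, inner_tangent_self_of_unit hB1,
    ← inner_conj_symm (tangent A.1)] at inner_eq
  have sub_conj := Complex.sub_conj (inner ℂ (tangent B.1) (tangent A.1))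
  push_cast at sub_conj ⊢
  linear_combination inner_eq + sub_conj / 2

theorem re_inner_tangent_eq_zero (hB : B ∈ cartanP n) (hB1 : innerAN B B = 1)
    (hA : A ∈ rootSpace B c) (hc : c ≠ 0) :
    (inner ℂ (tangent B.1) (tangent A.1)).re = 0 := by
  have re_eq := congrArg Complex.re (sq_mul_inner_tangent hB hB1 hA)
  rw [Complex.re_ofReal_mul, Complex.re_ofReal_mul, Complex.I_re, mul_zero] at re_eq
  exact (mul_eq_zero.1 re_eq).resolve_left (pow_ne_zero 2 hc)

theorem im_inner_tangent_eq_zero (hB : B ∈ cartanP n) (hB1 : innerAN B B = 1)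
    (hA : A ∈ rootSpace B c) (hc : c ^ 2 ≠ 1) :
    (inner ℂ (tangent B.1) (tangent A.1)).im = 0 := by
  have im_eq := congrArg Complex.im (sq_mul_inner_tangent hB hB1 hA)
  rw [Complex.im_ofReal_mul, Complex.im_ofReal_mul, Complex.I_im, mul_one] at im_eq
  exact (mul_left_eq_self₀.1 im_eq).resolve_left hc

theorem inner_tangent_eq_zero (hB : B ∈ cartanP n) (hB1 : innerAN B B = 1)
    (hA : A ∈ rootSpace B c) (hc : c ≠ 0) (hc1 : c ^ 2 ≠ 1) :
    inner ℂ (tangent B.1) (tangent A.1) = 0 :=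
  Complex.ext (re_inner_tangent_eq_zero hB hB1 hA hc) (im_inner_tangent_eq_zero hB hB1 hA hc1)

theorem eq_zero_of_mem_rootSpace (hB : B ∈ cartanP n) (hB1 : innerAN B B = 1)
    (hA : A ∈ rootSpace B c) (hc : 1 < c) : A = 0 := by
  have hc_sq : 1 < c ^ 2 := one_lt_pow₀ hc two_ne_zero
  have inner_eq_zero := inner_tangent_eq_zero hB hB1 hA (by linarith) hc_sq.ne'
  have factor_ne_zero : (c : ℂ) ^ 2 - 1 / 4 ≠ 0 := by
    have : c ^ 2 - 1 / 4 ≠ 0 := by linarith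
    simpa using Complex.ofReal_ne_zero.2 this
  have smul_eq_zero_tangent := rootSpace_smul_tangent hB hB1 hA
  rw [← inner_conj_symm (tangent A.1), inner_eq_zero, map_zero, mul_zero, sub_zero, zero_smul]
    at smul_eq_zero_tangent
  exact eq_zero_of_tangent_eq_zero hB hA (by linarith)
    ((smul_eq_zero.1 smul_eq_zero_tangent).resolve_left factor_ne_zero)

theorem exists_tangent_eq_smul_I_smul (hB : B ∈ cartanP n) (hB1 : innerAN B B = 1)
    (hA : A ∈ rootSpace B 1) :
    ∃ r : ℝ, tangent A.1 = r • Complex.I • tangent B.1 := by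
  have smul_tangent := rootSpace_smul_tangent hB hB1 hA
  have inner_eq := sq_mul_inner_tangent hB hB1 hA
  rw [← inner_conj_symm (tangent A.1)] at smul_tangent
  generalize inner ℂ (tangent B.1) (tangent A.1) = p at smul_tangent inner_eq
  rw [one_pow, Complex.ofReal_one, one_mul] at inner_eq
  refine ⟨4 * p.im, smul_right_injective _ (show (3 / 4 : ℂ) ≠ 0 by norm_num) ?_⟩
  have conj_eq_neg : starRingEnd ℂ p = -p := by
    rw [inner_eq, map_mul, Complex.conj_ofReal, Complex.conj_I, mul_neg]
  calc (3 / 4 : ℂ) • tangent A.1 = (((1 : ℝ) : ℂ) ^ 2 - 1 / 4) • tangent A.1 := by norm_num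
    _ = (3 * (p.im * Complex.I)) • tangent B.1 := by
      rw [smul_tangent, conj_eq_neg, ← inner_eq]
      ring_nf
    _ = (3 / 4 : ℂ) • (4 * p.im) • Complex.I • tangent B.1 := by
      rw [← Complex.coe_smul, smul_smul, smul_smul]
      push_cast
      ring_nf

end RootSpaces

section HighestRootSpace

variable {n : ℕ}

/-- The operator `z ↦ herm y z • x` of `ℂ^{1,n}`. -/
def rankOne (x y : Fin (n + 1) → ℂ) : Matrix (Fin (n + 1)) (Fin (n + 1)) ℂ :=
  Matrix.vecMulVec x (star y ᵥ* form n)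

theorem conjTranspose_form : (form n)ᴴ = form n := by
  ext i j
  cases i using Fin.cases <;> cases j using Fin.cases <;>
    simp [form, Matrix.diagonal_apply, Fin.succ_ne_zero, eq_comm, apply_ite]

theorem mul_rankOne (A : Matrix (Fin (n + 1)) (Fin (n + 1)) ℂ) (x y : Fin (n + 1) → ℂ) :
    A * rankOne x y = rankOne (A *ᵥ x) y :=
  Matrix.mul_vecMulVec A x _

theorem rankOne_mul (A : su n) (x y : Fin (n + 1) → ℂ) :
    rankOne x y * A.1 = -rankOne x (A.1 *ᵥ y) := by
  rw [rankOne, Matrix.vecMulVec_mul, Matrix.vecMul_vecMul, eq_neg_of_add_eq_zero_right A.2.1,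
    Matrix.vecMul_neg, ← Matrix.vecMul_vecMul, ← Matrix.star_mulVec, Matrix.vecMulVec_neg, rankOne]

theorem rankOne_smul_left (c : ℂ) (x y : Fin (n + 1) → ℂ) :
    rankOne (c • x) y = c • rankOne x y :=
  Matrix.smul_vecMulVec c x _

theorem rankOne_smul_right (c : ℂ) (x y : Fin (n + 1) → ℂ) :
    rankOne x (c • y) = star c • rankOne x y := by
  rw [rankOne, star_smul, Matrix.smul_vecMul, Matrix.vecMulVec_smul, rankOne]

theorem conjTranspose_rankOne_mul_form (x y : Fin (n + 1) → ℂ) :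
    (rankOne x y)ᴴ * form n = form n * rankOne y x := by
  rw [rankOne, Matrix.conjTranspose_vecMulVec, Matrix.star_vecMul, conjTranspose_form, star_star,
    Matrix.vecMulVec_mul, mul_rankOne, rankOne]

theorem trace_rankOne (x y : Fin (n + 1) → ℂ) : (rankOne x y).trace = herm y x := by
  rw [rankOne, Matrix.trace_vecMulVec, dotProduct_comm, ← Matrix.dotProduct_mulVec, herm]

theorem tangent_rankOne (c d : ℂ) (u v : EuclideanSpace ℂ (Fin n)) :
    tangent (rankOne (join c u) (join d v)) = -starRingEnd ℂ d • u := by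
  ext i
  simp [rankOne, tangent_apply, join, form, Matrix.vecMulVec_apply, Matrix.vecMul_diagonal,
    mul_comm]

theorem smul_rankOne_self_mem_su {c : ℂ} (hc : c.re = 0) {ξ : Fin (n + 1) → ℂ}
    (hξ : herm ξ ξ = 0) : c • rankOne ξ ξ ∈ su n := by
  refine ⟨?_, by rw [Matrix.trace_smul, trace_rankOne, hξ, smul_zero]⟩
  rw [Matrix.conjTranspose_smul, Matrix.smul_mul, Matrix.mul_smul,
    conjTranspose_rankOne_mul_form, ← add_smul]
  simp [Complex.ext_iff, hc]

variable {A B : su n} {c : ℝ}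

theorem mem_rootSpace_of_smul_rankOne_self {ξ : Fin (n + 1) → ℂ} (hξ : B.1 *ᵥ ξ = (c : ℂ) • ξ)
    {d : ℂ} (hA : A.1 = d • rankOne ξ ξ) : A ∈ rootSpace B (2 * c) := by
  refine mem_rootSpace.2 (Subtype.ext ?_)
  change B.1 * A.1 - A.1 * B.1 = (2 * c) • A.1
  rw [hA, Matrix.mul_smul, Matrix.smul_mul, mul_rankOne, rankOne_mul, hξ, rankOne_smul_left,
    rankOne_smul_right, Complex.star_def, Complex.conj_ofReal, ← Complex.coe_smul (2 * c)]
  push_cast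
  module

theorem exists_mem_rootSpace_one_tangent_eq (hB : B ∈ cartanP n) (hB1 : innerAN B B = 1) :
    ∃ Z ∈ rootSpace B 1, tangent Z.1 = Complex.I • tangent B.1 := by
  let ξ : Fin (n + 1) → ℂ := join 1 ((2 : ℂ) • tangent B.1)
  have isotropic : herm ξ ξ = 0 := by
    rw [herm_join, inner_smul_left, inner_smul_right, inner_tangent_self_of_unit hB1,
      map_ofNat, map_one]
    norm_num
  have eigenvector : B.1 *ᵥ ξ = ((1 / 2 : ℝ) : ℂ) • ξ := by
    rw [mulVec_join_of_mem_cartanP hB, smul_join, inner_smul_right, inner_tangent_self_of_unit hB1,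
      smul_smul]
    norm_num
  have mem_su : (-Complex.I / 2) • rankOne ξ ξ ∈ su n :=
    smul_rankOne_self_mem_su (by simp) isotropic
  refine ⟨⟨_, mem_su⟩, ?_, ?_⟩
  · simpa using mem_rootSpace_of_smul_rankOne_self eigenvector (A := ⟨_, mem_su⟩) rfl
  · have tangent_smul (d : ℂ) (C : Matrix (Fin (n + 1)) (Fin (n + 1)) ℂ) :
        tangent (d • C) = d • tangent C := rfl
    rw [tangent_smul, tangent_rankOne, map_one, smul_smul, smul_smul]
    congr 1
    ring

theorem rootSpace_one_eq_span (hB : B ∈ cartanP n) (hB1 : innerAN B B = 1) {Z : su n}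
    (hZ : Z ∈ rootSpace B 1) (tangent_Z : tangent Z.1 = Complex.I • tangent B.1) :
    rootSpace B 1 = Submodule.span ℝ {Z} := by
  refine le_antisymm (fun A hA => ?_) (Submodule.span_le.2 (Set.singleton_subset_iff.2 hZ))
  obtain ⟨r, tangent_A⟩ := exists_tangent_eq_smul_I_smul hB hB1 hA
  have sub_eq_zero' : A - r • Z = 0 := by
    refine eq_zero_of_tangent_eq_zero hB (sub_mem hA ((rootSpace B 1).smul_mem r hZ)) one_ne_zero ?_
    change tangent (A.1 - r • Z.1) = 0
    rw [map_sub, map_smul, tangent_A, tangent_Z, sub_self]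
  exact Submodule.mem_span_singleton.2 ⟨r, (sub_eq_zero.1 sub_eq_zero').symm⟩

end HighestRootSpace

section LieSubalgebras

theorem exists_lieSubalgebra_span_sup {R L : Type*} [CommRing R] [LieRing L] [LieAlgebra R L]
    {V : Submodule R L} {T : L} (hV : ∀ x ∈ V, ∀ y ∈ V, ⁅x, y⁆ ∈ V) (hT : ∀ x ∈ V, ⁅T, x⁆ ∈ V) :
    ∃ 𝔥 : LieSubalgebra R L, 𝔥.toSubmodule = Submodule.span R {T} ⊔ V := by
  refine ⟨{ Submodule.span R {T} ⊔ V with lie_mem' := ?_ }, rfl⟩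
  rintro x y hx hy
  obtain ⟨x₁, hx₁, x₂, hx₂, rfl⟩ := Submodule.mem_sup.1 hx
  obtain ⟨y₁, hy₁, y₂, hy₂, rfl⟩ := Submodule.mem_sup.1 hy
  obtain ⟨r, rfl⟩ := Submodule.mem_span_singleton.1 hx₁
  obtain ⟨s, rfl⟩ := Submodule.mem_span_singleton.1 hy₁
  refine Submodule.mem_sup_right ?_
  have lie_eq : ⁅r • T + x₂, s • T + y₂⁆ = r • ⁅T, y₂⁆ - s • ⁅T, x₂⁆ + ⁅x₂, y₂⁆ := by
    rw [← lie_skew T x₂]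
    simp only [add_lie, lie_add, smul_lie, lie_smul, lie_self, smul_zero, zero_add, smul_neg]
    abel
  change ⁅r • T + x₂, s • T + y₂⁆ ∈ V
  rw [lie_eq]
  exact add_mem (sub_mem (V.smul_mem r (hT y₂ hy₂)) (V.smul_mem s (hT x₂ hx₂))) (hV x₂ hx₂ y₂ hy₂)

variable {n : ℕ} {A A' B : su n} {c c' : ℝ} {w : Submodule ℝ (su n)}

theorem lie_mem_rootSpace (hA : A ∈ rootSpace B c) (hA' : A' ∈ rootSpace B c') :
    ⁅A, A'⁆ ∈ rootSpace B (c + c') := by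
  rw [mem_rootSpace] at *
  rw [leibniz_lie, hA, hA', smul_lie, lie_smul, add_smul]

theorem lie_mem_rootSpace_one (hB : B ∈ cartanP n) (hB1 : innerAN B B = 1)
    (hA : A ∈ rootSpace B (1 / 2) ⊔ rootSpace B 1)
    (hA' : A' ∈ rootSpace B (1 / 2) ⊔ rootSpace B 1) : ⁅A, A'⁆ ∈ rootSpace B 1 := by
  obtain ⟨W, hW, Z, hZ, rfl⟩ := Submodule.mem_sup.1 hA
  obtain ⟨W', hW', Z', hZ', rfl⟩ := Submodule.mem_sup.1 hA'
  have lie_eq_zero {c d : ℝ} {C D : su n} (hC : C ∈ rootSpace B c) (hD : D ∈ rootSpace B d)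
      (hcd : 1 < c + d) : ⁅C, D⁆ = 0 :=
    eq_zero_of_mem_rootSpace hB hB1 (lie_mem_rootSpace hC hD) hcd
  rw [add_lie, lie_add, lie_add, lie_eq_zero hW hZ' (by norm_num),
    lie_eq_zero hZ hW' (by norm_num), lie_eq_zero hZ hZ' (by norm_num), add_zero, add_zero,
    add_zero]
  simpa only [add_halves] using lie_mem_rootSpace hW hW'

theorem lie_mem_sup_rootSpace_one (hB : B ∈ cartanP n) (hB1 : innerAN B B = 1)
    (hw : w ≤ rootSpace B (1 / 2)) :
    ∀ A ∈ w ⊔ rootSpace B 1, ∀ A' ∈ w ⊔ rootSpace B 1, ⁅A, A'⁆ ∈ w ⊔ rootSpace B 1 :=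
  fun _ hA _ hA' => Submodule.mem_sup_right
    (lie_mem_rootSpace_one hB hB1 (sup_le_sup_right hw _ hA) (sup_le_sup_right hw _ hA'))

theorem exists_lieSubalgebra_nilpotent (hB : B ∈ cartanP n) (hB1 : innerAN B B = 1)
    (hw : w ≤ rootSpace B (1 / 2)) :
    ∃ 𝔥 : LieSubalgebra ℝ (su n), 𝔥.toSubmodule = w ⊔ rootSpace B 1 :=
  ⟨{ w ⊔ rootSpace B 1 with
      lie_mem' := fun {A A'} hA hA' => lie_mem_sup_rootSpace_one hB hB1 hw A hA A' hA' }, rfl⟩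

theorem exists_lieSubalgebra_solvable (hB : B ∈ cartanP n) (hB1 : innerAN B B = 1)
    (hw : w ≤ rootSpace B (1 / 2)) (a : ℝ) {X : su n} (hX : X ∈ rootSpace B (1 / 2)) :
    ∃ 𝔥 : LieSubalgebra ℝ (su n),
      𝔥.toSubmodule = Submodule.span ℝ {a • B + X} ⊔ w ⊔ rootSpace B 1 := by
  rw [sup_assoc]
  refine exists_lieSubalgebra_span_sup (lie_mem_sup_rootSpace_one hB hB1 hw) fun A hA => ?_
  obtain ⟨W, hW, Z, hZ, rfl⟩ := Submodule.mem_sup.1 hA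
  have lie_B_mem : ⁅B, W + Z⁆ ∈ w ⊔ rootSpace B 1 := by
    rw [lie_add, mem_rootSpace.1 (hw hW), mem_rootSpace.1 hZ]
    exact Submodule.add_mem_sup (w.smul_mem _ hW) ((rootSpace B 1).smul_mem _ hZ)
  rw [add_lie, smul_lie]
  exact add_mem (Submodule.smul_mem _ a lie_B_mem) (Submodule.mem_sup_right
    (lie_mem_rootSpace_one hB hB1 (Submodule.mem_sup_left hX) (sup_le_sup_right hw _ hA)))

end LieSubalgebras

section InnerAN

variable {n : ℕ}

theorem innerAN_comm (Y Y' : su n) : innerAN Y Y' = innerAN Y' Y :=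
  metric_comm _ _ _

theorem innerAN_add_left (Y₁ Y₂ Y : su n) : innerAN (Y₁ + Y₂) Y = innerAN Y₁ Y + innerAN Y₂ Y := by
  simp only [innerAN_eq, AddMemClass.coe_add, map_add, metric_add_left]

theorem innerAN_smul_left (c : ℝ) (Y Y' : su n) : innerAN (c • Y) Y' = c * innerAN Y Y' := by
  simp only [innerAN_eq, SetLike.val_smul, map_smul, metric_smul_left]

theorem innerAN_add_right (Y Y₁ Y₂ : su n) :
    innerAN Y (Y₁ + Y₂) = innerAN Y Y₁ + innerAN Y Y₂ := by
  simp only [innerAN_comm Y, innerAN_add_left]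

theorem innerAN_smul_right (c : ℝ) (Y Y' : su n) : innerAN Y (c • Y') = c * innerAN Y Y' := by
  simp only [innerAN_comm Y, innerAN_smul_left]

theorem innerAN_zero_left (Y : su n) : innerAN 0 Y = 0 := by
  simpa using innerAN_smul_left 0 0 Y

theorem innerAN_self_pos {Y : su n} (hY : tangent Y.1 ≠ 0) : 0 < innerAN Y Y := by
  rw [innerAN_eq]
  exact metric_self_pos (by simp) hY

theorem innerAN_self_nonneg (Y : su n) : 0 ≤ innerAN Y Y := by
  rcases eq_or_ne (tangent Y.1) 0 with hY | hY
  · simp [innerAN_eq, hY, metric_zero_base]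
  · exact (innerAN_self_pos hY).le

theorem exists_orthonormalAN_span_eq (w : Submodule ℝ (su n))
    (hw : ∀ Y ∈ w, tangent Y.1 = 0 → Y = 0) :
    ∃ W : Fin (Module.finrank ℝ w) → su n,
      OrthonormalAN W ∧ Submodule.span ℝ (Set.range W) = w := by
  let core : InnerProductSpace.Core ℝ w :=
    { inner := fun Y Y' => innerAN Y.1 Y'.1
      conj_inner_symm := fun Y Y' => innerAN_comm _ _
      re_inner_nonneg := fun Y => innerAN_self_nonneg _
      add_left := fun Y₁ Y₂ Y => innerAN_add_left _ _ _
      smul_left := fun Y Y' c => innerAN_smul_left _ _ _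
      definite := fun Y hY =>
        Subtype.ext (hw Y Y.2 (by_contra fun h => (innerAN_self_pos h).ne' hY)) }
  let _ : NormedAddCommGroup w := core.toNormedAddCommGroup
  let _ : InnerProductSpace ℝ w := InnerProductSpace.ofCore core.toCore
  let b := stdOrthonormalBasis ℝ w
  refine ⟨fun i => (b i).1, fun i j => orthonormal_iff_ite.1 b.orthonormal i j, ?_⟩
  have map_span_eq := congrArg (Submodule.map w.subtype) b.toBasis.span_eq
  rw [Submodule.map_span, Submodule.map_top, Submodule.range_subtype, ← Set.range_comp,
    b.coe_toBasis] at map_span_eq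
  exact map_span_eq

theorem OrthonormalAN.cons {k : ℕ} {A : Fin k → su n} (hA : OrthonormalAN A) {T : su n}
    (hT : innerAN T T = 1) (hTA : ∀ i, innerAN T (A i) = 0) :
    OrthonormalAN (Fin.cons T A : Fin (k + 1) → su n) := by
  intro i j
  cases i using Fin.cases <;> cases j using Fin.cases
  · simp [hT]
  · simp [hTA, (Fin.succ_ne_zero _).symm]
  · simp [innerAN_comm, hTA]
  · simp [hA _ _]

variable {B X Z : su n} {w : Submodule ℝ (su n)}

theorem inner_tangent_eq_zero_of_mem_rootSpace_half (hB : B ∈ cartanP n) (hB1 : innerAN B B = 1)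
    (hX : X ∈ rootSpace B (1 / 2)) : inner ℂ (tangent B.1) (tangent X.1) = 0 :=
  inner_tangent_eq_zero hB hB1 hX (by norm_num) (by norm_num)

theorem innerAN_rootSpace_half_one (hB : B ∈ cartanP n) (hB1 : innerAN B B = 1)
    (hX : X ∈ rootSpace B (1 / 2)) (hZ : Z ∈ rootSpace B 1) : innerAN Z X = 0 := by
  obtain ⟨r, tangent_Z⟩ := exists_tangent_eq_smul_I_smul hB hB1 hZ
  rw [innerAN_eq, tangent_Z, metric_smul_left, metric_zero_base, inner_smul_left,
    inner_tangent_eq_zero_of_mem_rootSpace_half hB hB1 hX]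
  simp

theorem innerAN_eq_zero_of_mem_rootSpace {c : ℝ} (hB : B ∈ cartanP n) (hB1 : innerAN B B = 1)
    (hX : X ∈ rootSpace B c) (hc : c ≠ 0) : innerAN B X = 0 := by
  rw [innerAN_eq, metric_zero_base, re_inner_tangent_eq_zero hB hB1 hX hc, mul_zero]

theorem innerAN_eq_zero_of_mem_sup_rootSpace_one {Y A : su n} (hYw : ∀ W ∈ w, innerAN Y W = 0)
    (hYZ : ∀ Z ∈ rootSpace B 1, innerAN Y Z = 0) (hA : A ∈ w ⊔ rootSpace B 1) :
    innerAN Y A = 0 := by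
  obtain ⟨W, hW, Z, hZ, rfl⟩ := Submodule.mem_sup.1 hA
  rw [innerAN_add_right, hYw W hW, hYZ Z hZ, add_zero]

end InnerAN

section Acceleration

variable {n : ℕ}

theorem lowerBlock_add (A C : Matrix (Fin (n + 1)) (Fin (n + 1)) ℂ) :
    lowerBlock (A + C) = lowerBlock A + lowerBlock C := by
  simp only [lowerBlock, Matrix.submatrix_add, Pi.add_apply, map_add]

theorem lowerBlock_smul (r : ℝ) (A : Matrix (Fin (n + 1)) (Fin (n + 1)) ℂ) :
    lowerBlock (r • A) = (r : ℂ) • lowerBlock A := by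
  rw [← Complex.coe_smul r A]
  simp only [lowerBlock, Matrix.submatrix_smul, Pi.smul_apply, map_smul]

theorem acceleration_smul (r : ℝ) (A : Matrix (Fin (n + 1)) (Fin (n + 1)) ℂ) :
    acceleration (r • A) = r ^ 2 • acceleration A := by
  simp only [acceleration, lowerBlock_smul, map_smul, Matrix.smul_apply, smul_sub]
  simp only [← Complex.coe_smul, smul_apply, map_smul, smul_smul, smul_eq_mul]
  push_cast
  module

variable {B X Z : su n}

theorem acceleration_smul_add (hB : B ∈ cartanP n) (hB1 : innerAN B B = 1) (a : ℝ)
    (hX : X ∈ rootSpace B (1 / 2)) :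
    acceleration (a • B + X).1 = (1 / 2 : ℝ) • tangent (innerAN X X • B - a • X).1 := by
  have inner_BX := inner_tangent_eq_zero_of_mem_rootSpace_half hB hB1 hX
  have inner_XB : inner ℂ (tangent X.1) (tangent B.1) = 0 := inner_eq_zero_symm.1 inner_BX
  have corner_X : X.1 0 0 = 0 := by
    simpa [inner_BX, inner_XB] using rootSpace_corner hB hX
  have lowerBlock_X (u : EuclideanSpace ℂ (Fin n)) : lowerBlock X.1 u = (2 : ℂ) •
      (inner ℂ (tangent X.1) u • tangent B.1 - inner ℂ (tangent B.1) u • tangent X.1) := by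
    rw [← rootSpace_lowerBlock hB hX, smul_smul]
    norm_num
  have corner_eq_zero : (a • B + X).1 0 0 = 0 := by
    simp [corner_of_mem_cartanP hB, corner_X]
  have lowerBlock_eq (u : EuclideanSpace ℂ (Fin n)) :
      lowerBlock (a • B + X).1 u = lowerBlock X.1 u := by
    rw [AddMemClass.coe_add, SetLike.val_smul, lowerBlock_add, lowerBlock_smul,
      lowerBlock_of_mem_cartanP hB, add_apply, smul_apply, zero_apply, smul_zero, zero_add]
  rw [acceleration, corner_eq_zero, lowerBlock_eq, lowerBlock_X, zero_smul, sub_zero]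
  simp only [AddMemClass.coe_add, SetLike.val_smul, AddSubgroupClass.coe_sub, map_add, map_sub,
    map_smul]
  simp only [← Complex.coe_smul, inner_add_right, inner_smul_right, inner_XB, inner_BX,
    inner_tangent_self_of_unit hB1, inner_tangent_self X]
  push_cast
  module

theorem acceleration_of_mem_rootSpace_half (hB : B ∈ cartanP n) (hB1 : innerAN B B = 1)
    (hX : X ∈ rootSpace B (1 / 2)) :
    acceleration X.1 = (innerAN X X / 2) • tangent B.1 := by
  have := acceleration_smul_add hB hB1 0 hX
  rwa [zero_smul, zero_smul, zero_add, sub_zero, SetLike.val_smul, map_smul, smul_smul,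
    one_div_mul_eq_div] at this

theorem acceleration_of_mem_rootSpace_one (hB : B ∈ cartanP n) (hB1 : innerAN B B = 1)
    (hZ : Z ∈ rootSpace B 1) : acceleration Z.1 = innerAN Z Z • tangent B.1 := by
  obtain ⟨r, tangent_Z⟩ := exists_tangent_eq_smul_I_smul hB hB1 hZ
  have innerAN_ZZ : (innerAN Z Z : ℂ) = 4 * inner ℂ (tangent Z.1) (tangent Z.1) := by
    rw [inner_tangent_self]
    ring
  have corner_Z := rootSpace_corner hB hZ
  have lowerBlock_Z := rootSpace_lowerBlock hB hZ (tangent Z.1)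
  rw [Complex.ofReal_one, one_mul] at corner_Z
  rw [Complex.ofReal_one, one_smul] at lowerBlock_Z
  rw [acceleration, corner_Z, lowerBlock_Z, ← Complex.coe_smul (innerAN Z Z), innerAN_ZZ, tangent_Z]
  simp only [← Complex.coe_smul, inner_smul_left, inner_smul_right, Complex.conj_ofReal,
    Complex.conj_I, inner_tangent_self_of_unit hB1]
  module

end Acceleration

section MeanCurvature

variable {n : ℕ}

theorem metric_smul_sub_smul_of_orthogonal {z b x ν : EuclideanSpace ℂ (Fin n)} {a : ℝ} (s : ℝ)
    (hν : metric z ν (a • b + x) = 0) :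
    metric z (s • b - a • x) ν = (a ^ 2 + s) * metric z b ν := by
  simp only [metric_comm z _ ν, ← metricForm_apply, map_add, map_sub, map_smul, smul_eq_mul] at hν ⊢
  linear_combination (-a) * hν

variable {B X : su n} {w : Submodule ℝ (su n)} {𝔥 : LieSubalgebra ℝ (su n)}

theorem exists_orthonormalAN_nilpotent (hB : B ∈ cartanP n) (hB1 : innerAN B B = 1)
    (hw : w ≤ rootSpace B (1 / 2)) :
    ∃ A : Fin (Module.finrank ℝ w + 1) → su n, OrthonormalAN A ∧
      Submodule.span ℝ (Set.range A) = w ⊔ rootSpace B 1 ∧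
      ∑ i, acceleration (A i).1 = ((2 + Module.finrank ℝ w : ℝ) / 2) • tangent B.1 := by
  obtain ⟨W, hW, span_W⟩ := exists_orthonormalAN_span_eq w fun Y hY =>
    eq_zero_of_tangent_eq_zero hB (hw hY) (by norm_num)
  obtain ⟨Z, hZ, tangent_Z⟩ := exists_mem_rootSpace_one_tangent_eq hB hB1
  have W_mem (i) : W i ∈ rootSpace B (1 / 2) :=
    hw (span_W ▸ Submodule.subset_span (Set.mem_range_self i))
  have innerAN_ZZ : innerAN Z Z = 1 := by
    rw [← hB1, innerAN_eq, innerAN_eq, tangent_Z, metric_zero_base, metric_zero_base,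
      inner_smul_left, inner_smul_right]
    simp
  have acceleration_W (i) : acceleration (W i).1 = (1 / 2 : ℝ) • tangent B.1 := by
    rw [acceleration_of_mem_rootSpace_half hB hB1 (W_mem i), hW i i, if_pos rfl]
  refine ⟨Fin.cons Z W, hW.cons innerAN_ZZ fun i => innerAN_rootSpace_half_one hB hB1 (W_mem i) hZ,
    ?_, ?_⟩
  · rw [Fin.range_cons, Submodule.span_insert, span_W, ← rootSpace_one_eq_span hB hB1 hZ tangent_Z,
      sup_comm]
  · simp only [Fin.sum_univ_succ, Fin.cons_zero, Fin.cons_succ, acceleration_W,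
      acceleration_of_mem_rootSpace_one hB hB1 hZ, innerAN_ZZ, Finset.sum_const, Finset.card_univ,
      Fintype.card_fin]
    module

theorem orbitHasMeanCurvature_nilpotent (hB : B ∈ cartanP n) (hB1 : innerAN B B = 1)
    (hw : w ≤ rootSpace B (1 / 2)) (h𝔥 : 𝔥.toSubmodule = w ⊔ rootSpace B 1) :
    OrbitHasMeanCurvature 𝔥 (((2 + Module.finrank ℝ w : ℝ) / 2) • B) := by
  obtain ⟨A, hA, span_A, sum_A⟩ := exists_orthonormalAN_nilpotent hB hB1 hw
  have normal_B (i) : innerAN B (A i) = 0 :=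
    innerAN_eq_zero_of_mem_sup_rootSpace_one
      (fun W hW => innerAN_eq_zero_of_mem_rootSpace hB hB1 (hw hW) (by norm_num))
      (fun Z hZ => innerAN_eq_zero_of_mem_rootSpace hB hB1 hZ one_ne_zero)
      (span_A ▸ Submodule.subset_span (Set.mem_range_self i))
  refine orbitHasMeanCurvature_of_orthonormalAN hA (span_A.trans h𝔥.symm)
    (fun i => by rw [innerAN_smul_left, normal_B, mul_zero]) fun ν _ => ?_
  rw [sum_A, SetLike.val_smul, map_smul]

theorem innerAN_smul_add_eq_zero (hB : B ∈ cartanP n) (hB1 : innerAN B B = 1)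
    (hw : w ≤ rootSpace B (1 / 2)) (hX : X ∈ rootSpace B (1 / 2)) (hXw : ∀ W ∈ w, innerAN X W = 0)
    (c d : ℝ) {A : su n} (hA : A ∈ w ⊔ rootSpace B 1) : innerAN (c • B + d • X) A = 0 := by
  refine innerAN_eq_zero_of_mem_sup_rootSpace_one (fun W hW => ?_) (fun Z hZ => ?_) hA
  · rw [innerAN_add_left, innerAN_smul_left, innerAN_smul_left, hXw W hW,
      innerAN_eq_zero_of_mem_rootSpace hB hB1 (hw hW) (by norm_num), mul_zero, mul_zero, add_zero]
  · rw [innerAN_add_left, innerAN_smul_left, innerAN_smul_left, innerAN_comm X,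
      innerAN_rootSpace_half_one hB hB1 hX hZ,
      innerAN_eq_zero_of_mem_rootSpace hB hB1 hZ one_ne_zero, mul_zero, mul_zero, add_zero]

theorem innerAN_smul_add_smul (hB : B ∈ cartanP n) (hB1 : innerAN B B = 1)
    (hX : X ∈ rootSpace B (1 / 2)) (c d c' d' : ℝ) :
    innerAN (c • B + d • X) (c' • B + d' • X) = c * c' + d * d' * innerAN X X := by
  have innerAN_BX := innerAN_eq_zero_of_mem_rootSpace hB hB1 hX (by norm_num)
  simp only [innerAN_add_left, innerAN_add_right, innerAN_smul_left, innerAN_smul_right,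
    innerAN_comm X B, innerAN_BX, hB1]
  ring

theorem innerAN_smul_sub_smul_eq_zero (hB : B ∈ cartanP n) (hB1 : innerAN B B = 1)
    (hw : w ≤ rootSpace B (1 / 2)) (hX : X ∈ rootSpace B (1 / 2)) (hXw : ∀ W ∈ w, innerAN X W = 0)
    {a : ℝ} {A : su n} (hA : A ∈ Submodule.span ℝ {a • B + X} ⊔ w ⊔ rootSpace B 1) :
    innerAN (innerAN X X • B - a • X) A = 0 := by
  rw [sup_assoc] at hA
  obtain ⟨T, hT, C, hC, rfl⟩ := Submodule.mem_sup.1 hA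
  obtain ⟨t, rfl⟩ := Submodule.mem_span_singleton.1 hT
  have orthogonal := innerAN_smul_add_smul hB hB1 hX (innerAN X X) (-a) a 1
  rw [one_smul] at orthogonal
  rw [sub_eq_add_neg, ← neg_smul, innerAN_add_right, innerAN_smul_right, orthogonal,
    innerAN_smul_add_eq_zero hB hB1 hw hX hXw _ _ hC]
  ring

theorem exists_orthonormalAN_solvable (hB : B ∈ cartanP n) (hB1 : innerAN B B = 1)
    (hw : w ≤ rootSpace B (1 / 2)) {a : ℝ} (ha : a ≠ 0) (hX : X ∈ rootSpace B (1 / 2))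
    (hXw : ∀ W ∈ w, innerAN X W = 0) :
    ∃ A : Fin (Module.finrank ℝ w + 1 + 1) → su n, OrthonormalAN A ∧
      Submodule.span ℝ (Set.range A) = Submodule.span ℝ {a • B + X} ⊔ w ⊔ rootSpace B 1 ∧
      ∑ i, acceleration (A i).1 =
        (1 / (2 * (a ^ 2 + innerAN X X))) • tangent (innerAN X X • B - a • X).1 +
          ((2 + Module.finrank ℝ w : ℝ) / 2) • tangent B.1 := by
  obtain ⟨A, hA, span_A, sum_A⟩ := exists_orthonormalAN_nilpotent hB hB1 hw
  have normSq_pos : 0 < a ^ 2 + innerAN X X :=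
    add_pos_of_pos_of_nonneg (sq_pos_of_ne_zero ha) (innerAN_self_nonneg X)
  let r : ℝ := (√(a ^ 2 + innerAN X X))⁻¹
  have hr : r ^ 2 = (a ^ 2 + innerAN X X)⁻¹ := by rw [inv_pow, Real.sq_sqrt normSq_pos.le]
  have hr0 : r ≠ 0 := inv_ne_zero (Real.sqrt_ne_zero'.2 normSq_pos)
  let T : su n := r • (a • B + X)
  have T_eq : T = (r * a) • B + r • X := by rw [mul_smul, ← smul_add]
  have unit_T : innerAN T T = 1 := by
    rw [T_eq, innerAN_smul_add_smul hB hB1 hX, ← mul_inv_cancel₀ normSq_pos.ne', ← hr]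
    ring
  have T_orthogonal (i) : innerAN T (A i) = 0 :=
    T_eq ▸ innerAN_smul_add_eq_zero hB hB1 hw hX hXw _ _
      (span_A ▸ Submodule.subset_span (Set.mem_range_self i))
  refine ⟨Fin.cons T A, hA.cons unit_T T_orthogonal, ?_, ?_⟩
  · rw [Fin.range_cons, Submodule.span_insert, span_A,
      Submodule.span_singleton_smul_eq (IsUnit.mk0 r hr0), sup_assoc]
  · simp only [Fin.sum_univ_succ, Fin.cons_zero, Fin.cons_succ] at sum_A ⊢
    rw [sum_A, SetLike.val_smul, acceleration_smul, acceleration_smul_add hB hB1 a hX, smul_smul,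
      hr, inv_mul_eq_div, div_div]

theorem orbitHasMeanCurvature_solvable (hB : B ∈ cartanP n) (hB1 : innerAN B B = 1)
    (hw : w ≤ rootSpace B (1 / 2)) {a : ℝ} (ha : a ≠ 0) (hX : X ∈ rootSpace B (1 / 2))
    (hXw : ∀ W ∈ w, innerAN X W = 0)
    (h𝔥 : 𝔥.toSubmodule = Submodule.span ℝ {a • B + X} ⊔ w ⊔ rootSpace B 1) :
    OrbitHasMeanCurvature 𝔥
      (((3 + Module.finrank ℝ w : ℝ) / (2 * (a ^ 2 + innerAN X X))) •
        (innerAN X X • B - a • X)) := by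
  obtain ⟨A, hA, span_A, sum_A⟩ := exists_orthonormalAN_solvable hB hB1 hw ha hX hXw
  have normal_A (i) : innerAN (innerAN X X • B - a • X) (A i) = 0 :=
    innerAN_smul_sub_smul_eq_zero hB hB1 hw hX hXw
      (span_A ▸ Submodule.subset_span (Set.mem_range_self i))
  refine orbitHasMeanCurvature_of_orthonormalAN hA (span_A.trans h𝔥.symm)
    (fun i => by rw [innerAN_smul_left, normal_A, mul_zero]) fun ν hν => ?_
  have normSq_ne_zero : a ^ 2 + innerAN X X ≠ 0 :=
    (add_pos_of_pos_of_nonneg (sq_pos_of_ne_zero ha) (innerAN_self_nonneg X)).ne'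
  have orthogonal : metric 0 ν (a • tangent B.1 + tangent X.1) = 0 := by
    have := metric_tangent_eq_zero_of_mem_span hν (X := a • B + X) (span_A ▸
      Submodule.mem_sup_left (Submodule.mem_sup_left (Submodule.mem_span_singleton_self _)))
    simpa using this
  have metric_normal : metric 0 (tangent (innerAN X X • B - a • X).1) ν =
      (a ^ 2 + innerAN X X) * metric 0 (tangent B.1) ν := by
    simpa using metric_smul_sub_smul_of_orthogonal (innerAN X X) orthogonal
  rw [sum_A, SetLike.val_smul, map_smul, metric_smul_left, metric_add_left, metric_smul_left,
    metric_smul_left, metric_normal]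
  field_simp
  ring

end MeanCurvature

end ComplexHyperbolic

end

open ComplexHyperbolic in
/-- `B` is a unit vector of `𝔞 = ℝB ⊆ 𝔭`, and `α` is the restricted root with `α(B) = 1/2`, so that
`𝔤_α = rootSpace B (1/2)` and `𝔤_{2α} = rootSpace B 1`. -/
theorem mainTheorem11 (n : ℕ) (B : su n) (hB : B ∈ cartanP n) (hB1 : innerAN B B = 1)
    (w : Submodule ℝ (su n)) (hw : w ≤ rootSpace B (1 / 2)) :
    (∀ (a : ℝ) (X : su n), a ≠ 0 → X ≠ 0 → X ∈ rootSpace B (1 / 2) →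
      (∀ W ∈ w, innerAN X W = 0) →
      ∃ 𝔥 : LieSubalgebra ℝ (su n),
        𝔥.toSubmodule = Submodule.span ℝ {a • B + X} ⊔ w ⊔ rootSpace B 1 ∧
        OrbitHasMeanCurvature 𝔥
          (((3 + Module.finrank ℝ w : ℝ) / (2 * (a ^ 2 + innerAN X X))) •
            (innerAN X X • B - a • X))) ∧
    (∃ 𝔥 : LieSubalgebra ℝ (su n),
      𝔥.toSubmodule = Submodule.span ℝ {B} ⊔ w ⊔ rootSpace B 1 ∧
      OrbitHasMeanCurvature 𝔥 0) ∧
    (∃ 𝔥 : LieSubalgebra ℝ (su n),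
      𝔥.toSubmodule = w ⊔ rootSpace B 1 ∧
      OrbitHasMeanCurvature 𝔥 (((2 + Module.finrank ℝ w : ℝ) / 2) • B)) := by
  refine ⟨fun a X ha _ hX hXw => ?_, ?_, ?_⟩
  · obtain ⟨𝔥, h𝔥⟩ := exists_lieSubalgebra_solvable hB hB1 hw a hX
    exact ⟨𝔥, h𝔥, orbitHasMeanCurvature_solvable hB hB1 hw ha hX hXw h𝔥⟩
  · have zero_mem := (rootSpace B (1 / 2)).zero_mem
    obtain ⟨𝔥, h𝔥⟩ := exists_lieSubalgebra_solvable hB hB1 hw 1 zero_mem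
    have meanCurvature := orbitHasMeanCurvature_solvable hB hB1 hw one_ne_zero zero_mem
      (fun W _ => innerAN_zero_left W) h𝔥
    exact ⟨𝔥, by simpa using h𝔥, by simpa [innerAN_zero_left] using meanCurvature⟩
  · obtain ⟨𝔥, h𝔥⟩ := exists_lieSubalgebra_nilpotent hB hB1 hw
    exact ⟨𝔥, h𝔥, orbitHasMeanCurvature_nilpotent hB hB1 hw h𝔥⟩
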